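/- Let $q$ be a prime power and represent $\mathrm{PG}(2,q^3)$, with line at infinity $\ell_\infty: z=0$, in $\mathrm{PG}(6,q)$ by the Bruck–Bose map: with respect to a fixed basis of $\mathrm{GF}(q^3)$ over $\mathrm{GF}(q)$, the affine point $(\alpha,\beta,1)$ is sent to $\sigma(\alpha,\beta,1)=(a_0,a_1,a_2,b_0,b_1,b_2,1)$, where $(a_i),(b_i)$ are the coordinates of $\alpha,\beta$. A point $L=(\alpha,\beta,0)$ of $\ell_\infty$ corresponds to the plane $[L]=\{\sigma(\lambda\alpha,\lambda\beta,0):\lambda\in\mathrm{GF}(q^3)\setminus\{0\}\}$ of the hyperplane $\Sigma_\infty: z=0$; these planes form a regular spread $\mathcal S$. A transversal of $\mathcal S$ is a line $g$ of the extension of $\Sigma_\infty$ to $\mathrm{PG}(6,q^3)$, disjoint from $\mathrm{PG}(6,q)$, such that the elements of $\mathcal S$ are exactly the intersections with $\mathrm{PG}(6,q)$ of the planes $\langle P,P^q,P^{q^2}\rangle$, $P\in g$. An order-$q$-subplane of $\mathrm{PG}(2,q^3)$ is an image of $\mathrm{PG}(2,q)$ under $\mathrm{PGL}(3,q^3)$;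 an order-$q$-subline is the point set of a line of such a subplane, and its extension is the line of $\mathrm{PG}(2,q^3)$ containing it. If $\ell$ is an order-$q$-subline disjoint from $\ell_\infty$ whose extension meets $\ell_\infty$ in $L$, then the corresponding point set $[\ell]$ of $\mathrm{PG}(6,q)$ is a special twisted cubic: a twisted cubic $s^3c_0+s^2tc_1+st^2c_2+t^3c_3$ of a $3$-space containing $[L]$ and not contained in $\Sigma_\infty$, whose extension to $\mathrm{PG}(6,q^3)$ meets the transversals of $\mathcal S$. The shadow of $\ell$ is the set of points in which the tangent lines of this special twisted cubic (at its points over $\mathrm{GF}(q)$) meet $[L]$. Let $\mathscr B$ be an order-$q$-subplane that meets $\ell_\infty$ in exactly one point $T$, let $\mathscr S_T$ be its tangent splash, i.e. the set of points of $\ell_\infty$ that lie on (the extension of) a line of $\mathscr B$, and let $L\in\mathscr S_T$, $L\ne T$. Then there are exactly $q^2+q+1$ distinct shadows in the spread element $[L]$; moreover, for each line $m\ne\ell_\infty$ of $\mathrm{PG}(2,q^3)$ through $L$, there are exactly $q^2+q+1$ distinct shadows in $[L]$ of order-$q$-sublines that are disjoint from $\ell_\infty$ and have extension $m$. -/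

import Mathlib

open scoped LinearAlgebra.Projectivization

namespace BruckBose

/-! ### The plane `PG(2,q³)`

`K` is the field `GF(q)` and `F` is its cubic extension `GF(q³)`.  Points of `PG(2,q³)` have
homogeneous coordinates `(x,y,z)`, the line at infinity is `z = 0`, and a line is given by a
two-dimensional subspace of `F³`. -/

/-- The line at infinity of `PG(2,q³)`, as a subspace: `z = 0`. -/
def lineInfty (F : Type*) [Field F] : Submodule F (Fin 3 → F) :=
  LinearMap.ker (LinearMap.proj 2)

/-- An order-`q`-subplane: the image of `PG(2,q)` under an element of `PGL(3,q³)`. -/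
def IsSubplane (K : Type*) {F : Type*} [Field K] [Field F] [Algebra K F]
    (B : Set (ℙ F (Fin 3 → F))) : Prop :=
  ∃ A : Matrix.GeneralLinearGroup (Fin 3) F,
    B = {P | ∃ v : Fin 3 → K, v ≠ 0 ∧
      P.submodule = Submodule.span F {(A : Matrix (Fin 3) (Fin 3) F).mulVec
        (fun i => algebraMap K F (v i))}}

/-- The line `m` of `PG(2,q³)` is (the extension of) a line of the subplane `B`: it contains at
least two points of `B`. -/
def IsLineOf {F : Type*} [Field F] (B : Set (ℙ F (Fin 3 → F)))
    (m : Submodule F (Fin 3 → F)) : Prop :=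
  Module.finrank F m = 2 ∧ (B ∩ (m.projectivization : Set (ℙ F (Fin 3 → F)))).Nontrivial

/-- `B` is an order-`q`-subplane tangent to the line at infinity in the point `T`. -/
def IsTangentSubplane (K : Type*) {F : Type*} [Field K] [Field F] [Algebra K F]
    (B : Set (ℙ F (Fin 3 → F))) (T : ℙ F (Fin 3 → F)) : Prop :=
  IsSubplane K B ∧ B ∩ ((lineInfty F).projectivization : Set (ℙ F (Fin 3 → F))) = {T}

/-- The splash of `B`: the points of the line at infinity that lie on a line of `B`. -/
def splash {F : Type*} [Field F] (B : Set (ℙ F (Fin 3 → F))) : Set (ℙ F (Fin 3 → F)) :=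
  {P | P ∈ (lineInfty F).projectivization ∧ ∃ m, IsLineOf B m ∧ P ∈ m.projectivization}

/-- `l` is an order-`q`-subline whose extension to `PG(2,q³)` is the line `m`: it is the point
set of a line of some order-`q`-subplane. -/
def IsSubline (K : Type*) {F : Type*} [Field K] [Field F] [Algebra K F]
    (m : Submodule F (Fin 3 → F)) (l : Set (ℙ F (Fin 3 → F))) : Prop :=
  ∃ B : Set (ℙ F (Fin 3 → F)), IsSubplane K B ∧ IsLineOf B m ∧
    l = B ∩ (m.projectivization : Set (ℙ F (Fin 3 → F)))

/-! ### The Bruck-Bose representation in `PG(6,q)`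

Points of `PG(6,q)` have homogeneous coordinates `(x₀,x₁,x₂,y₀,y₁,y₂,z)`.  The coordinates
of elements of `GF(q³)` over `GF(q)` are taken with respect to a basis `b`, for instance
`1, τ, τ²` with `τ` a primitive element. -/

/-- The (generalised) Bruck-Bose map `σ(α,β,z) = (a₀,a₁,a₂,b₀,b₁,b₂,z)`, with `z` in `GF(q)`. -/
noncomputable def sigma {K F : Type*} [Field K] [Field F] [Algebra K F]
    (b : Module.Basis (Fin 3) K F) (α β : F) (z : K) : Fin 7 → K :=
  ![b.repr α 0, b.repr α 1, b.repr α 2, b.repr β 0, b.repr β 1, b.repr β 2, z]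

/-- The hyperplane at infinity `z = 0` of `PG(6,k)`. -/
def hyperplaneInfty (k : Type*) [Field k] : Submodule k (Fin 7 → k) :=
  LinearMap.ker (LinearMap.proj 6)

/-- The set `[X]` of affine points of `PG(6,q)` corresponding to the affine points of a point
set `X` of `PG(2,q³)`. -/
def affineImage {K F : Type*} [Field K] [Field F] [Algebra K F]
    (b : Module.Basis (Fin 3) K F) (X : Set (ℙ F (Fin 3 → F))) : Set (ℙ K (Fin 7 → K)) :=
  {Q | ∃ P ∈ X, ∃ α β : F, ![α, β, 1] ∈ P.submodule ∧
    Q.submodule = Submodule.span K {sigma b α β 1}}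

/-- The spread element `[L]` corresponding to a point `L` of the line at infinity. -/
def spreadElement {K F : Type*} [Field K] [Field F] [Algebra K F]
    (b : Module.Basis (Fin 3) K F) (L : ℙ F (Fin 3 → F)) : Submodule K (Fin 7 → K) :=
  Submodule.span K {w | ∃ α β : F, ![α, β, 0] ∈ L.submodule ∧ w = sigma b α β 0}

/-- The regular spread `S` of the hyperplane at infinity. -/
def spread {K F : Type*} [Field K] [Field F] [Algebra K F]
    (b : Module.Basis (Fin 3) K F) : Set (Submodule K (Fin 7 → K)) :=
  {W | ∃ L ∈ (lineInfty F).projectivization, W = spreadElement b L}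

/-! ### The cubic extension `PG(6,q³)` of `PG(6,q)` -/

/-- The embedding of `PG(6,q)` in `PG(6,q³)`, on coordinate vectors. -/
def embed {K : Type*} (F : Type*) [Field K] [Field F] [Algebra K F] (v : Fin 7 → K) :
    Fin 7 → F :=
  fun i => algebraMap K F (v i)

/-- The conjugation `P ↦ P^q` of `PG(6,q³)`, on coordinate vectors. -/
noncomputable def conj (K : Type*) {F : Type*} [Field F] (v : Fin 7 → F) : Fin 7 → F :=
  fun i => v i ^ Nat.card K

/-- The intersection with `PG(6,q)` of a subspace of `PG(6,q³)`. -/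
def rationalPart (K : Type*) {F : Type*} [Field K] [Field F] [Algebra K F]
    (U : Submodule F (Fin 7 → F)) : Submodule K (Fin 7 → K) where
  carrier := {v | embed F v ∈ U}
  zero_mem' := by
    have h : embed F (0 : Fin 7 → K) = 0 := by funext i; simp [embed]
    simp [h]
  add_mem' := by
    intro v w hv hw
    have h : embed F (v + w) = embed F v + embed F w := by funext i; simp [embed]
    simpa [h] using U.add_mem hv hw
  smul_mem' := by
    intro c v hv
    have h : embed F (c • v) = algebraMap K F c • embed F v := by funext i; simp [embed]
    simpa [h] using U.smul_mem (algebraMap K F c) hv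

/-- `g` is a transversal line of the regular spread: a line of the extension of the hyperplane
at infinity, disjoint from `PG(6,q)`, such that the spread elements are exactly the
intersections with `PG(6,q)` of the planes `⟨P, P^q, P^(q²)⟩`, where `P` is a point of `g`. -/
def IsTransversal {K F : Type*} [Field K] [Field F] [Algebra K F]
    (b : Module.Basis (Fin 3) K F) (g : Submodule F (Fin 7 → F)) : Prop :=
  Module.finrank F g = 2 ∧ g ≤ hyperplaneInfty F ∧ rationalPart K g = ⊥ ∧
    spread b = {W | ∃ P ∈ g, P ≠ 0 ∧
      W = rationalPart K (Submodule.span F {P, conj K P, conj K (conj K P)})}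

/-! ### Twisted cubics and shadows -/

/-- The vector `s³c₀ + s²t c₁ + st² c₂ + t³c₃`.  If `c₀,c₁,c₂,c₃` are linearly independent,
these are the points of a twisted cubic in the `3`-space `⟨c₀,c₁,c₂,c₃⟩`. -/
def cubic {k : Type*} [Field k] (c : Fin 4 → Fin 7 → k) (s t : k) : Fin 7 → k :=
  s ^ 3 • c 0 + (s ^ 2 * t) • c 1 + (s * t ^ 2) • c 2 + t ^ 3 • c 3

/-- The points of `PG(6,q)` on the twisted cubic. -/
def cubicPoints {k : Type*} [Field k] (c : Fin 4 → Fin 7 → k) : Set (ℙ k (Fin 7 → k)) :=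
  {Q | ∃ s t : k, (s, t) ≠ (0, 0) ∧ Q.submodule = Submodule.span k {cubic c s t}}

/-- The tangent line of the twisted cubic at the point with parameter `(s,t)`: it is spanned by
the point and the two partial derivatives of `cubic c` there.  (The point is listed
because in characteristic three it need not be in the span of the partial derivatives.) -/
def tangentLine {k : Type*} [Field k] (c : Fin 4 → Fin 7 → k) (s t : k) :
    Submodule k (Fin 7 → k) :=
  Submodule.span k {cubic c s t,
    (3 * s ^ 2) • c 0 + (2 * s * t) • c 1 + t ^ 2 • c 2,
    s ^ 2 • c 1 + (2 * s * t) • c 2 + (3 * t ^ 2) • c 3}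

/-- `c` parametrises a special twisted cubic in a `3`-space about `[L]` that is not contained in
the hyperplane at infinity: its extension to `PG(6,q³)` meets the transversals of the spread. -/
def IsSpecialCubic {K F : Type*} [Field K] [Field F] [Algebra K F]
    (b : Module.Basis (Fin 3) K F) (L : ℙ F (Fin 3 → F)) (c : Fin 4 → Fin 7 → K) : Prop :=
  LinearIndependent K c ∧
  spreadElement b L ≤ Submodule.span K (Set.range c) ∧
  ¬ Submodule.span K (Set.range c) ≤ hyperplaneInfty K ∧
  ∀ g : Submodule F (Fin 7 → F), IsTransversal b g →
    ∃ s t : F, (s, t) ≠ (0, 0) ∧ cubic (fun i => embed F (c i)) s t ∈ g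

/-- The set of points in which the tangent lines of the twisted cubic meet `[L]`. -/
def shadowPoints {K F : Type*} [Field K] [Field F] [Algebra K F]
    (b : Module.Basis (Fin 3) K F) (L : ℙ F (Fin 3 → F)) (c : Fin 4 → Fin 7 → K) :
    Set (ℙ K (Fin 7 → K)) :=
  {Q | ∃ s t : K, (s, t) ≠ (0, 0) ∧ Q.submodule ≤ tangentLine c s t ⊓ spreadElement b L}

/-- `D` is the shadow in `[L]` of the order-`q`-subline `l`, where `L` is the point at infinity
of the extension of `l`: the point set `[l]` is a special twisted cubic in a `3`-space about
`[L]`, and `D` is the set of points in which its tangent lines meet `[L]`. -/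
def IsShadowOf {K F : Type*} [Field K] [Field F] [Algebra K F]
    (b : Module.Basis (Fin 3) K F) (L : ℙ F (Fin 3 → F)) (l : Set (ℙ F (Fin 3 → F)))
    (D : Set (ℙ K (Fin 7 → K))) : Prop :=
  ∃ c : Fin 4 → Fin 7 → K, IsSpecialCubic b L c ∧ cubicPoints c = affineImage b l ∧
    D = shadowPoints b L c

/-- The shadows in `[L]` of the order-`q`-sublines that are disjoint from the line at infinity
and whose extension is the line `m` (used for lines `m` through `L`). -/
def shadowsOn {K F : Type*} [Field K] [Field F] [Algebra K F]
    (b : Module.Basis (Fin 3) K F) (L : ℙ F (Fin 3 → F)) (m : Submodule F (Fin 3 → F)) :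
    Set (Set (ℙ K (Fin 7 → K))) :=
  {D | ∃ l : Set (ℙ F (Fin 3 → F)), IsSubline K m l ∧
    Disjoint l ((lineInfty F).projectivization : Set (ℙ F (Fin 3 → F))) ∧ IsShadowOf b L l D}

/-- All shadows in the spread element `[L]`. -/
def shadowsIn {K F : Type*} [Field K] [Field F] [Algebra K F]
    (b : Module.Basis (Fin 3) K F) (L : ℙ F (Fin 3 → F)) : Set (Set (ℙ K (Fin 7 → K))) :=
  {D | ∃ m : Submodule F (Fin 3 → F), L ∈ m.projectivization ∧ D ∈ shadowsOn b L m}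

end BruckBose

/-! Fix a vector `ℓ` spanning `L`. Then `x ↦ xℓ` identifies `[L]` with `F` as a `K`-space, and every
shadow becomes an explicit set. Let a subline disjoint from infinity consist of the points `s a + t
d`, with `d 2 = δ * a 2`, `δ ∉ K` and `d - δ a = ρ ℓ`. Multiplying the affine point `(s a + t d)/(s
+ δ t)` by the norm of `s + δ t`, which lies in `K`, gives the cubic `(s a + t d)(s + δ^q t)(s +
δ^(q²) t)`. Differentiating the affine point shows that the tangent at `(s, t)` meets `[L]` in `ρ
ℓ/(s + δ t)²`. So the shadow is `squarePoints`: the classes of `ρ/w²`, for `w ≠ 0` in the `K`-plane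
`W = ⟨1, δ⟩` of `F` (`Factors.shadowPoints_eq`).

Any two planes `⟨1, δ⟩`, `⟨1, ε⟩` differ by a factor in `F`, so `W` can be fixed once and for all,
with only `ρ` varying (`exists_pencil_eq_smul`). Two values of `ρ` give the same set exactly when
their ratio lies in `K` (`exists_smul_eq_of_squarePoints_eq`, `squarePoints_smul`). Hence the
shadows correspond to the points of `ℙ K F`, a projective plane of order `q`.

It remains to match special cubics with this form. Every special cubic factors as above
(`IsSpecialCubic.exists_factors`), which uses one explicit transversal. Conversely, on every line `m
≠ ℓ∞` through `L`, each `δ ∉ K` and `ρ ≠ 0` occurs (`squarePoints_mem_shadowsOn`). This requires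
knowing all transversals, namely that each contains one of the three explicit ones
(`IsTransversal.exists_transversal_le`). -/

namespace BruckBose

/-! ### Arithmetic of the cubic extension `F / K`. -/

section CubicExtension

variable {K F : Type*} [Field K] [Field F] [Algebra K F]

/-- `φ` is the Frobenius automorphism `x ↦ x ^ q` of a cubic extension of `K = GF(q)`. -/
structure IsCubicFrobenius (φ : F ≃ₐ[K] F) : Prop where
  apply_eq_pow : ∀ x, φ x = x ^ Nat.card K
  apply_cube : ∀ x, φ (φ (φ x)) = x
  exists_of_fixed : ∀ x, φ x = x → ∃ k : K, algebraMap K F k = x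
  eq_of_mem_gal : ∀ τ : F ≃ₐ[K] F, τ = 1 ∨ τ = φ ∨ τ = φ * φ

theorem exists_isCubicFrobenius [Finite K] (hF : Module.finrank K F = 3) :
    ∃ φ : F ≃ₐ[K] F, IsCubicFrobenius φ := by
  have : Module.Finite K F := Module.finite_of_finrank_pos (by omega)
  have := Fintype.ofFinite K
  have : Finite F := Module.finite_of_finite K
  let φ := FiniteField.frobeniusAlgEquivOfAlgebraic K F
  have hφ : ∀ x, φ x = x ^ Nat.card K := fun x => by
    rw [Nat.card_eq_fintype_card]; rfl
  have ho : φ ^ 3 = 1 := by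
    rw [← hF, ← FiniteField.orderOf_frobeniusAlgEquivOfAlgebraic K F]
    exact pow_orderOf_eq_one φ
  have hgal : ∀ τ : F ≃ₐ[K] F, τ = 1 ∨ τ = φ ∨ τ = φ * φ := by
    intro τ
    obtain ⟨⟨n, hn⟩, rfl⟩ := (FiniteField.bijective_frobeniusAlgEquivOfAlgebraic_pow K F).2 τ
    rw [hF] at hn
    interval_cases n
    · left; simp
    · right; left; simp [φ]
    · right; right; simp [φ, pow_two]
  refine ⟨φ, hφ, fun x => ?_, fun x hx => ?_, hgal⟩
  · have := congrArg (fun τ : F ≃ₐ[K] F => τ x) ho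
    simpa [pow_succ] using this
  · have h : ∀ τ : F ≃ₐ[K] F, τ x = x := by
      intro τ
      rcases hgal τ with rfl | rfl | rfl <;> simp [hx]
    exact (IsGalois.mem_range_algebraMap_iff_fixed x).2 h

/-- The degree of `y` divides the prime 3 and is not 1, so no nonzero polynomial of degree at most 2
kills `y`. -/
theorem quadratic_eq_zero (hF : Module.finrank K F = 3) {y : F}
    (hy : y ∉ Set.range (algebraMap K F)) {x₀ x₁ x₂ : K}
    (h : algebraMap K F x₀ + algebraMap K F x₁ * y + algebraMap K F x₂ * y ^ 2 = 0) :
    x₀ = 0 ∧ x₁ = 0 ∧ x₂ = 0 := by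
  have : Module.Finite K F := Module.finite_of_finrank_pos (by omega)
  have hint : IsIntegral K y := Algebra.IsIntegral.isIntegral y
  have hd : (minpoly K y).natDegree = 3 := by
    have h1 : (minpoly K y).natDegree ∣ 3 := hF ▸ minpoly.degree_dvd hint
    rcases (Nat.dvd_prime Nat.prime_three).1 h1 with h | h
    · exact absurd (minpoly.natDegree_eq_one_iff.1 h) hy
    · exact h
  let p : Polynomial K := .C x₀ + .C x₁ * .X + .C x₂ * .X ^ 2
  have hp : p = 0 := by
    by_contra hp
    have := Polynomial.natDegree_le_of_dvd
      (minpoly.dvd K y (p := p) (by simpa [p] using h)) hp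
    have h2 : p.natDegree ≤ 2 := by simp only [p]; compute_degree
    omega
  refine ⟨?_, ?_, ?_⟩
  · simpa [p, Polynomial.coeff_X, Polynomial.coeff_C] using congrArg (fun r => r.coeff 0) hp
  · simpa [p, Polynomial.coeff_X, Polynomial.coeff_C, Polynomial.coeff_X_pow]
      using congrArg (fun r => r.coeff 1) hp
  · simpa [p, Polynomial.coeff_X, Polynomial.coeff_C] using congrArg (fun r => r.coeff 2) hp

theorem mem_range_of_sq_mem_range (hF : Module.finrank K F = 3) {x : F} {k : K}
    (h : x ^ 2 = algebraMap K F k) : x ∈ Set.range (algebraMap K F) := by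
  by_contra hx
  have := quadratic_eq_zero hF hx (x₀ := k) (x₁ := 0) (x₂ := -1) (by simp [h])
  simp at this

/-- The norm `x ^ (q² + q + 1)` lies in `K` and its exponent is odd, say `2h + 1`, so `x` is the
norm times the square of `x ^ (-h)`. -/
theorem exists_eq_sq_mul [Finite K] (hF : Module.finrank K F = 3) {x : F} (hx : x ≠ 0) :
    ∃ (r : F) (k : K), r ≠ 0 ∧ k ≠ 0 ∧ x = algebraMap K F k * r ^ 2 := by
  have : Module.Finite K F := Module.finite_of_finrank_pos (by omega)
  have := Fintype.ofFinite K
  have : Finite F := Module.finite_of_finite K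
  obtain ⟨φ, hφ⟩ := exists_isCubicFrobenius (F := F) hF
  set q := Nat.card K with hq
  obtain ⟨h, hh⟩ : ∃ h, q ^ 2 + q + 1 = 2 * h + 1 := by
    obtain ⟨m, hm⟩ := Nat.even_mul_succ_self q
    exact ⟨m, by nlinarith⟩
  have hfix : φ (x ^ (q ^ 2 + q + 1)) = x ^ (q ^ 2 + q + 1) := by
    have h3 := hφ.apply_cube x
    simp only [hφ.apply_eq_pow, ← pow_mul, ← hq] at h3 ⊢
    calc x ^ ((q ^ 2 + q + 1) * q) = x ^ (q * q * q) * x ^ (q ^ 2 + q) := by ring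
      _ = _ := by rw [h3]; ring
  obtain ⟨k, hk⟩ := hφ.exists_of_fixed _ hfix
  refine ⟨(x ^ h)⁻¹, k, by positivity, ?_, ?_⟩
  · rintro rfl
    rw [map_zero] at hk
    exact (pow_ne_zero _ hx) hk.symm
  · rw [hk, hh]
    field_simp
    ring

/-- For `r ∉ K` and `w ≠ 0` in `W`, the vectors `w, rw, r²w` would be three independent vectors of
the plane `W`. -/
theorem mem_range_of_mul_mem (hF : Module.finrank K F = 3) (W : Submodule K F)
    (hW : Module.finrank K W = 2) {r : F} (hr : ∀ w ∈ W, r * w ∈ W) :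
    r ∈ Set.range (algebraMap K F) := by
  have : Module.Finite K F := Module.finite_of_finrank_pos (by omega)
  by_contra hy
  obtain ⟨w, hw, hw0⟩ := W.exists_mem_ne_zero_of_ne_bot (by rintro rfl; simp at hW)
  have hli : LinearIndependent K ![(⟨w, hw⟩ : W), ⟨r * w, hr w hw⟩,
      ⟨r * (r * w), hr _ (hr w hw)⟩] := by
    rw [Fintype.linearIndependent_iff]
    intro g hg
    have hg := congrArg Subtype.val hg
    simp [Fin.sum_univ_three, Algebra.smul_def] at hg
    have h0 : algebraMap K F (g 0) + algebraMap K F (g 1) * r + algebraMap K F (g 2) * r ^ 2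
        = 0 := by
      apply mul_right_cancel₀ hw0
      linear_combination hg
    obtain ⟨h0, h1, h2⟩ := quadratic_eq_zero hF hy h0
    intro i; fin_cases i <;> assumption
  have := hli.fintype_card_le_finrank
  rw [hW] at this
  simp at this

/-- The two-dimensional space of all `s + δ t` with `s`, `t` in `K`. -/
def pencil (K : Type*) {F : Type*} [Field K] [Field F] [Algebra K F] (δ : F) : Submodule K F :=
  Submodule.span K {1, δ}

theorem mem_pencil {δ w : F} :
    w ∈ pencil K δ ↔ ∃ s t : K, algebraMap K F s + algebraMap K F t * δ = w := by
  simp [pencil, Submodule.mem_span_pair, Algebra.smul_def]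

theorem add_mul_ne_zero {δ : F} (hδ : δ ∉ Set.range (algebraMap K F)) {s t : K}
    (h : (s, t) ≠ (0, 0)) : algebraMap K F s + algebraMap K F t * δ ≠ 0 := by
  intro h0
  by_cases ht : t = 0
  · subst ht
    simp at h0
    exact h (by simp [h0])
  · apply hδ
    refine ⟨-s / t, ?_⟩
    have : algebraMap K F t ≠ 0 := by simpa using ht
    rw [map_div₀, map_neg]
    field_simp
    linear_combination -h0

theorem finrank_pencil {δ : F} (hδ : δ ∉ Set.range (algebraMap K F)) :
    Module.finrank K (pencil K δ) = 2 := by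
  have h : LinearIndependent K ![(1 : F), δ] := by
    rw [LinearIndependent.pair_iff]
    intro s t h
    by_contra hst
    refine add_mul_ne_zero hδ (s := s) (t := t) (fun h' => hst ?_) ?_
    · simpa using h'
    · simpa [Algebra.smul_def] using h
  have hs : pencil K δ = Submodule.span K (Set.range ![(1 : F), δ]) := by
    rw [pencil]
    congr 1
    ext x
    simp [or_comm, eq_comm]
  rw [hs, finrank_span_eq_card h]
  rfl

/-- A relation `g₀ + g₁ε + g₂δ + g₃δε = 0` exists because `F` has dimension 3. With `r = g₂ + g₃ε`
it says that `r` and `rδ = -(g₀ + g₁ε)` both lie in `⟨1, ε⟩`. -/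
theorem exists_pencil_eq_smul (hF : Module.finrank K F = 3) {δ ε : F}
    (hδ : δ ∉ Set.range (algebraMap K F)) (hε : ε ∉ Set.range (algebraMap K F)) :
    ∃ r : F, r ≠ 0 ∧ ∀ w, w ∈ pencil K δ ↔ r * w ∈ pencil K ε := by
  have : Module.Finite K F := Module.finite_of_finrank_pos (by omega)
  have hdep : ¬ LinearIndependent K ![1, ε, δ, δ * ε] := by
    intro h
    have := h.fintype_card_le_finrank
    rw [hF] at this
    simp at this
  rw [Fintype.not_linearIndependent_iff] at hdep
  obtain ⟨g, hg, i, hi⟩ := hdep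
  simp [Fin.sum_univ_four, Algebra.smul_def] at hg
  have h23 : (g 2, g 3) ≠ (0, 0) := by
    intro h
    simp only [Prod.mk.injEq] at h
    have h01 : (g 0, g 1) ≠ (0, 0) := by
      intro h'
      simp only [Prod.mk.injEq] at h'
      apply hi
      fin_cases i <;> simp [h, h']
    apply add_mul_ne_zero hε h01
    rw [h.1, h.2] at hg
    simpa using hg
  let r := algebraMap K F (g 2) + algebraMap K F (g 3) * ε
  have hr : r ≠ 0 := add_mul_ne_zero hε h23
  have hle : (pencil K δ).map (LinearMap.mulLeft K r) ≤ pencil K ε := by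
    rw [Submodule.map_le_iff_le_comap]
    intro w hw
    obtain ⟨s, t, rfl⟩ := mem_pencil.1 hw
    rw [Submodule.mem_comap, mem_pencil]
    refine ⟨s * g 2 - t * g 0, s * g 3 - t * g 1, ?_⟩
    simp only [LinearMap.mulLeft_apply, r, map_sub, map_mul]
    linear_combination -algebraMap K F t * hg
  have hinj : Function.Injective (LinearMap.mulLeft K r) := fun x y h => by
    simpa [hr] using h
  have heq : (pencil K δ).map (LinearMap.mulLeft K r) = pencil K ε := by
    apply Submodule.eq_of_le_of_finrank_eq hle
    rw [(Submodule.equivMapOfInjective _ hinj _).finrank_eq.symm, finrank_pencil hδ,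
      finrank_pencil hε]
  refine ⟨r, hr, fun w => ?_⟩
  rw [← heq]
  constructor
  · exact fun h => ⟨w, h, rfl⟩
  · rintro ⟨w', h, h'⟩
    rwa [← hinj h']

theorem exists_notMem_range (hF : Module.finrank K F = 3) :
    ∃ δ : F, δ ∉ Set.range (algebraMap K F) := by
  by_contra! h
  have h1 : (⊥ : Subalgebra K F) = ⊤ := by
    ext x
    simpa [Algebra.mem_bot] using h x
  rw [Subalgebra.bot_eq_top_iff_finrank_eq_one] at h1
  omega

theorem IsCubicFrobenius.ne_one {φ : F ≃ₐ[K] F} (hφ : IsCubicFrobenius φ)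
    (hF : Module.finrank K F = 3) : φ ≠ 1 := by
  rintro rfl
  obtain ⟨δ, hδ⟩ := exists_notMem_range hF
  exact hδ (hφ.exists_of_fixed δ rfl)

theorem IsCubicFrobenius.mul_self_ne_one {φ : F ≃ₐ[K] F} (hφ : IsCubicFrobenius φ)
    (hF : Module.finrank K F = 3) : φ * φ ≠ 1 := by
  intro h
  apply hφ.ne_one hF
  ext x
  have h1 := congrArg (fun τ : F ≃ₐ[K] F => τ (φ x)) h
  simp only [AlgEquiv.mul_apply, hφ.apply_cube, AlgEquiv.one_apply] at h1
  exact h1.symm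

end CubicExtension

/-! ### Conjugate coordinates on `PG(6,q³)`. -/

section Coordinates

variable {K F : Type*} [Field K] [Field F] [Algebra K F] (b : Module.Basis (Fin 3) K F)

theorem finrank_eq_three (b : Module.Basis (Fin 3) K F) : Module.finrank K F = 3 := by
  simpa using Module.finrank_eq_card_basis b

/-- The matrix `(τ(bᵢ))` is invertible by Dedekind's independence of characters. Hence a vector over
`F` amounts to three independent vectors of plane coordinates, one for each `τ`, sharing the last
entry. -/
theorem existsUnique_conj_coords [Finite K] (f : (F ≃ₐ[K] F) → F) :
    ∃! x : Fin 3 → F, ∀ τ : F ≃ₐ[K] F,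
      x 0 * τ (b 0) + x 1 * τ (b 1) + x 2 * τ (b 2) = f τ := by
  have hF := finrank_eq_three b
  have : Module.Finite K F := Module.Finite.of_basis b
  have : Finite F := Module.finite_of_finite K
  have hc : Nat.card (F ≃ₐ[K] F) = 3 := by rw [IsGalois.card_aut_eq_finrank, hF]
  let e₀ : Fin 3 ≃ (F ≃ₐ[K] F) := (Finite.equivFinOfCardEq hc).symm
  let M : Matrix (Fin 3) (Fin 3) F := fun i j => e₀ j (b i)
  have hind : LinearIndependent F fun j x => e₀ j x := by
    refine (linearIndependent_monoidHom F F).comp (fun j => ((e₀ j : F →* F))) ?_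
    intro i j h
    apply e₀.injective
    ext x
    exact DFunLike.congr_fun h x
  have hM : IsUnit M.det := by
    rw [← Matrix.isUnit_iff_isUnit_det, ← Matrix.mulVec_injective_iff_isUnit,
      ← Matrix.coe_mulVecLin, ← LinearMap.ker_eq_bot, LinearMap.ker_eq_bot']
    intro w hw
    have hb : ∀ i, ∑ j, w j * e₀ j (b i) = 0 := fun i => by
      have := congrFun hw i
      simp only [Matrix.mulVecLin_apply, Matrix.mulVec, dotProduct] at this
      simpa [M, mul_comm] using this
    have hl : ∑ j, w j • (e₀ j).toLinearMap = 0 := by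
      apply b.ext
      intro i
      simpa using hb i
    have h0 := Fintype.linearIndependent_iff.1 hind w (by
      ext x
      simpa using LinearMap.congr_fun hl x)
    exact funext h0
  have hv : ∀ (x : Fin 3 → F) (j : Fin 3), Matrix.vecMul x M j
      = x 0 * e₀ j (b 0) + x 1 * e₀ j (b 1) + x 2 * e₀ j (b 2) := by
    intro x j
    simp only [Matrix.vecMul, dotProduct, Fin.sum_univ_three]
    rfl
  have key : ∀ x : Fin 3 → F, (∀ τ : F ≃ₐ[K] F,
      x 0 * τ (b 0) + x 1 * τ (b 1) + x 2 * τ (b 2) = f τ) ↔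
      Matrix.vecMul x M = fun j => f (e₀ j) := by
    intro x
    rw [funext_iff, ← e₀.forall_congr_right]
    exact forall_congr' fun j => by rw [hv]
  simp only [key]
  refine ⟨Matrix.vecMul (fun j => f (e₀ j)) M⁻¹, ?_, fun y hy => ?_⟩
  · simp [Matrix.vecMul_vecMul, Matrix.nonsing_inv_mul M hM]
  · simp only at hy
    rw [← hy, Matrix.vecMul_vecMul, Matrix.mul_nonsing_inv M hM, Matrix.vecMul_one]

/-- The `F`-linear map that sends `(x, y, z)` to `(∑ xᵢ τ(bᵢ), ∑ yᵢ τ(bᵢ), z)`. -/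
noncomputable def conjCoords (τ : F ≃ₐ[K] F) : (Fin 7 → F) →ₗ[F] (Fin 3 → F) where
  toFun v := ![v 0 * τ (b 0) + v 1 * τ (b 1) + v 2 * τ (b 2),
    v 3 * τ (b 0) + v 4 * τ (b 1) + v 5 * τ (b 2), v 6]
  map_add' v w := by
    ext i; fin_cases i <;> simp <;> ring
  map_smul' c v := by
    ext i; fin_cases i <;> simp <;> ring

/-- The coordinates in `PG(2,q³)` of a vector of `PG(6,q)`. -/
noncomputable def planeCoords : (Fin 7 → K) →ₗ[K] (Fin 3 → F) where
  toFun v := conjCoords b 1 (embed F v)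
  map_add' v w := by
    rw [show embed F (v + w) = embed F v + embed F w by funext i; simp [embed], map_add]
  map_smul' c v := by
    rw [show embed F (c • v) = algebraMap K F c • embed F v by funext i; simp [embed], map_smul]
    ext i; simp [Algebra.smul_def]

theorem conjCoords_apply_two (τ : F ≃ₐ[K] F) (v : Fin 7 → F) : conjCoords b τ v 2 = v 6 := rfl

theorem planeCoords_apply_two (v : Fin 7 → K) : planeCoords b v 2 = algebraMap K F (v 6) := rfl

theorem planeCoords_smul (k : K) (v : Fin 7 → K) (i : Fin 3) :
    planeCoords b (k • v) i = algebraMap K F k * planeCoords b v i := by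
  rw [map_smul, Pi.smul_apply, Algebra.smul_def]

theorem conjCoords_embed (τ : F ≃ₐ[K] F) (v : Fin 7 → K) :
    conjCoords b τ (embed F v) = fun i => τ (planeCoords b v i) := by
  ext i
  fin_cases i
  · simp [planeCoords, conjCoords, embed]
  · simp [planeCoords, conjCoords, embed]
  · simp [planeCoords, conjCoords, embed]

theorem planeCoords_sigma (α β : F) (z : K) :
    planeCoords b (sigma b α β z) = ![α, β, algebraMap K F z] := by
  have h : ∀ x : F, algebraMap K F (b.repr x 0) * b 0 + algebraMap K F (b.repr x 1) * b 1
      + algebraMap K F (b.repr x 2) * b 2 = x := fun x => by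
    have := b.sum_repr x
    simpa [Fin.sum_univ_three, Algebra.smul_def] using this
  ext i
  fin_cases i
  · simpa [planeCoords, conjCoords, embed, sigma] using h α
  · simpa [planeCoords, conjCoords, embed, sigma] using h β
  · simp [planeCoords, conjCoords, embed, sigma]

theorem sigma_planeCoords (v : Fin 7 → K) :
    sigma b (planeCoords b v 0) (planeCoords b v 1) (v 6) = v := by
  have h : ∀ (x : Fin 3 → K) (i : Fin 3), b.repr (algebraMap K F (x 0) * b 0
      + algebraMap K F (x 1) * b 1 + algebraMap K F (x 2) * b 2) i = x i := fun x i => by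
    have := congrFun (b.repr_sum_self x) i
    simpa [Fin.sum_univ_three, Algebra.smul_def] using this
  have h0 := h ![v 0, v 1, v 2]
  have h1 := h ![v 3, v 4, v 5]
  ext i
  fin_cases i
  · exact h0 0
  · exact h0 1
  · exact h0 2
  · exact h1 0
  · exact h1 1
  · exact h1 2
  · rfl

theorem planeCoords_injective : Function.Injective (planeCoords b) := fun v w h => by
  rw [← sigma_planeCoords b v, ← sigma_planeCoords b w, h]
  have := congrFun h 2
  simp only [planeCoords_apply_two] at this
  rw [(algebraMap K F).injective this]

theorem eq_of_conjCoords_eq [Finite K] {v w : Fin 7 → F}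
    (h : ∀ τ : F ≃ₐ[K] F, conjCoords b τ v = conjCoords b τ w) : v = w := by
  have h0 := (existsUnique_conj_coords b (fun τ => conjCoords b τ v 0)).unique
    (y₁ := ![v 0, v 1, v 2]) (y₂ := ![w 0, w 1, w 2]) (fun τ => rfl)
    (fun τ => by rw [h]; rfl)
  have h1 := (existsUnique_conj_coords b (fun τ => conjCoords b τ v 1)).unique
    (y₁ := ![v 3, v 4, v 5]) (y₂ := ![w 3, w 4, w 5]) (fun τ => rfl)
    (fun τ => by rw [h]; rfl)
  ext i
  fin_cases i
  · exact congrFun h0 0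
  · exact congrFun h0 1
  · exact congrFun h0 2
  · exact congrFun h1 0
  · exact congrFun h1 1
  · exact congrFun h1 2
  · exact congrFun (h 1) 2

theorem exists_conjCoords_eq [Finite K] (f : (F ≃ₐ[K] F) → Fin 3 → F) (hf : ∀ τ, f τ 2 = 0) :
    ∃ v, ∀ τ, conjCoords b τ v = f τ := by
  obtain ⟨x, hx, -⟩ := existsUnique_conj_coords b (fun τ => f τ 0)
  obtain ⟨y, hy, -⟩ := existsUnique_conj_coords b (fun τ => f τ 1)
  refine ⟨![x 0, x 1, x 2, y 0, y 1, y 2, 0], fun τ => ?_⟩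
  ext i
  fin_cases i
  · exact hx τ
  · exact hy τ
  · exact (hf τ).symm

/-- Conjugation permutes the three coordinate systems cyclically; `φ * (φ * τ)` is `φ⁻¹ * τ`, since
`φ³ = 1`. -/
theorem conjCoords_conj {φ : F ≃ₐ[K] F} (hφ : IsCubicFrobenius φ) (τ : F ≃ₐ[K] F)
    (v : Fin 7 → F) (i : Fin 3) :
    conjCoords b τ (conj K v) i = φ (conjCoords b (φ * (φ * τ)) v i) := by
  have h : ∀ x, φ (φ (φ x)) = x := hφ.apply_cube
  fin_cases i <;> simp [conjCoords, conj, h, ← hφ.apply_eq_pow]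

theorem mem_lineInfty_iff {ℓ : Fin 3 → F} : ℓ ∈ lineInfty F ↔ ℓ 2 = 0 := Iff.rfl

theorem mem_spreadElement {L : ℙ F (Fin 3 → F)} (hL : L ∈ (lineInfty F).projectivization)
    {v : Fin 7 → K} : v ∈ spreadElement b L ↔ planeCoords b v ∈ L.submodule := by
  rw [Submodule.mem_projectivization_iff_submodule_le] at hL
  constructor
  · intro hv
    have : spreadElement b L ≤ (L.submodule.restrictScalars K).comap (planeCoords b) := by
      rw [spreadElement, Submodule.span_le]
      rintro _ ⟨α, β, h, rfl⟩
      simpa [planeCoords_sigma] using h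
    exact this hv
  · intro h
    have h2 : planeCoords b v 2 = 0 := hL h
    have h6 : v 6 = 0 := by simpa [planeCoords_apply_two] using h2
    apply Submodule.subset_span
    refine ⟨planeCoords b v 0, planeCoords b v 1, ?_, ?_⟩
    · convert h using 1
      ext i; fin_cases i <;> simp [h2]
    · rw [← h6, sigma_planeCoords]

end Coordinates

/-! ### The transversals of the regular spread. -/

section Transversals

variable {K F : Type*} [Field K] [Field F] [Algebra K F] (b : Module.Basis (Fin 3) K F)

/-- The three transversal lines of the regular spread, indexed by the Galois group. -/
noncomputable def transversal (τ : F ≃ₐ[K] F) : Submodule F (Fin 7 → F) where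
  carrier := {v | v 6 = 0 ∧ ∀ κ, κ ≠ τ → conjCoords b κ v = 0}
  zero_mem' := by simp
  add_mem' := by
    rintro v w ⟨hv, hv'⟩ ⟨hw, hw'⟩
    exact ⟨by simp [hv, hw], fun κ h => by simp [hv' κ h, hw' κ h]⟩
  smul_mem' := by
    rintro c v ⟨hv, hv'⟩
    exact ⟨by simp [hv], fun κ h => by simp [hv' κ h]⟩

theorem finrank_lineInfty : Module.finrank F (lineInfty F) = 2 := by
  have h := LinearMap.finrank_range_add_finrank_ker (LinearMap.proj 2 : (Fin 3 → F) →ₗ[F] F)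
  have hs : LinearMap.range (LinearMap.proj 2 : (Fin 3 → F) →ₗ[F] F) = ⊤ :=
    LinearMap.range_eq_top.2 (LinearMap.proj_surjective 2)
  rw [hs] at h
  simp at h
  rw [lineInfty]
  omega

/-- The transversal lines are copies of the line at infinity. -/
noncomputable def transversalMap (τ : F ≃ₐ[K] F) : transversal b τ →ₗ[F] lineInfty F :=
  ((conjCoords b τ).domRestrict _).codRestrict _ fun v => v.2.1

theorem transversalMap_bijective [Finite K] (τ : F ≃ₐ[K] F) :
    Function.Bijective (transversalMap b τ) := by
  constructor
  · intro v w h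
    have h1 : conjCoords b τ v = conjCoords b τ w := congrArg Subtype.val h
    apply Subtype.ext
    apply eq_of_conjCoords_eq b
    intro κ
    by_cases hκ : κ = τ
    · rw [hκ, h1]
    · rw [v.2.2 κ hκ, w.2.2 κ hκ]
  · rintro ⟨ℓ, hℓ⟩
    classical
    obtain ⟨v, hv⟩ := exists_conjCoords_eq b (fun κ => if κ = τ then ℓ else 0) (fun κ => by
      by_cases h : κ = τ
      · simpa [h] using mem_lineInfty_iff.1 hℓ
      · simp [h])
    have hvτ : conjCoords b τ v = ℓ := by simp [hv]
    refine ⟨⟨v, ?_, fun κ hκ => by simp [hv, hκ]⟩, Subtype.ext hvτ⟩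
    rw [← conjCoords_apply_two b τ v, hvτ]
    exact hℓ

theorem finrank_transversal [Finite K] (τ : F ≃ₐ[K] F) :
    Module.finrank F (transversal b τ) = 2 := by
  rw [(LinearEquiv.ofBijective _ (transversalMap_bijective b τ)).finrank_eq, finrank_lineInfty]

theorem rationalPart_transversal [Finite K] : rationalPart K (transversal b 1) = ⊥ := by
  rw [eq_bot_iff]
  intro v hv
  obtain ⟨φ, hφ⟩ := exists_isCubicFrobenius (K := K) (F := F) (finrank_eq_three b)
  have h := hv.2 φ (hφ.ne_one (finrank_eq_three b))
  rw [conjCoords_embed] at h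
  rw [Submodule.mem_bot]
  apply planeCoords_injective b
  ext i
  have := congrFun h i
  simpa using this

/-- The points `P, P^q, P^(q²)` live in the coordinate systems of `1, φ, φ²` respectively. A
combination with coefficients `x, y, z` is therefore rational when `y = φ x` and `z = φ² x`, and its
plane coordinates are `x` times those of `P`. -/
theorem rationalPart_span_eq_spreadElement [Finite K] {P : Fin 7 → F} (hP : P ∈ transversal b 1)
    {L : ℙ F (Fin 3 → F)} (hL : L ∈ (lineInfty F).projectivization)
    (hPL : L.submodule = Submodule.span F {conjCoords b 1 P}) :
    rationalPart K (Submodule.span F {P, conj K P, conj K (conj K P)}) = spreadElement b L := by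
  obtain ⟨φ, hφ⟩ := exists_isCubicFrobenius (K := K) (F := F) (finrank_eq_three b)
  have h1 := hφ.ne_one (finrank_eq_three b)
  have h2 := hφ.mul_self_ne_one (finrank_eq_three b)
  have h3 : φ * (φ * φ) = 1 := by ext x; simpa using hφ.apply_cube x
  have hφP : conjCoords b φ P = 0 := hP.2 _ h1
  have hφφP : conjCoords b (φ * φ) P = 0 := hP.2 _ h2
  have hcube := hφ.apply_cube
  have c0 : conjCoords b 1 (conj K P) = 0 := by
    ext i; rw [conjCoords_conj b hφ, mul_one, hφφP]; simp
  have c1 : conjCoords b φ (conj K P) = fun i => φ (conjCoords b 1 P i) := by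
    ext i; rw [conjCoords_conj b hφ, h3]
  have c2 : conjCoords b (φ * φ) (conj K P) = 0 := by
    ext i; rw [conjCoords_conj b hφ, h3, mul_one, hφP]; simp
  have d0 : conjCoords b 1 (conj K (conj K P)) = 0 := by
    ext i; rw [conjCoords_conj b hφ, mul_one, c2]; simp
  have d1 : conjCoords b φ (conj K (conj K P)) = 0 := by
    ext i; rw [conjCoords_conj b hφ, h3, c0]; simp
  have d2 : conjCoords b (φ * φ) (conj K (conj K P)) =
      fun i => φ (φ (conjCoords b 1 P i)) := by
    ext i; rw [conjCoords_conj b hφ, h3, mul_one, c1]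
  ext v
  rw [mem_spreadElement b hL, hPL, Submodule.mem_span_singleton]
  change embed F v ∈ Submodule.span F {P, conj K P, conj K (conj K P)} ↔ _
  rw [Submodule.mem_span_triple]
  constructor
  · rintro ⟨x, y, z, h⟩
    refine ⟨x, ?_⟩
    have := congrArg (conjCoords b 1) h
    rw [map_add, map_add, map_smul, map_smul, map_smul, c0, d0, conjCoords_embed] at this
    simpa using this
  · rintro ⟨x, h⟩
    refine ⟨x, φ x, φ (φ x), ?_⟩
    apply eq_of_conjCoords_eq b
    intro τ
    rw [map_add, map_add, map_smul, map_smul, map_smul, conjCoords_embed, ← h]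
    rcases hφ.eq_of_mem_gal τ with rfl | rfl | rfl
    · ext i; simp [c0, d0]
    · ext i; simp [c1, d1, hφP]
    · ext i; simp [c2, d2, hφφP]

theorem isTransversal_transversal [Finite K] : IsTransversal b (transversal b 1) := by
  refine ⟨finrank_transversal b 1, fun v hv => hv.1, rationalPart_transversal b, ?_⟩
  ext W
  constructor
  · rintro ⟨L, hL, rfl⟩
    have hrep : L.rep ∈ lineInfty F := by
      rw [Submodule.mem_projectivization_iff_submodule_le, L.submodule_eq,
        Submodule.span_singleton_le_iff_mem] at hL
      exact hL
    obtain ⟨⟨P, hP⟩, hPL⟩ := (transversalMap_bijective b 1).2 ⟨L.rep, hrep⟩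
    have hPL' : conjCoords b 1 P = L.rep := congrArg Subtype.val hPL
    refine ⟨P, hP, ?_, ?_⟩
    · rintro rfl
      exact L.rep_nonzero (by rw [← hPL', map_zero])
    · rw [rationalPart_span_eq_spreadElement b hP hL (by rw [hPL', L.submodule_eq])]
  · rintro ⟨P, hP, hP0, rfl⟩
    have h0 : conjCoords b 1 P ≠ 0 := by
      intro h
      have := (transversalMap_bijective b 1).1 (a₁ := ⟨P, hP⟩) (a₂ := 0)
        (Subtype.ext (h.trans (by rw [map_zero]; rfl)))
      exact hP0 (congrArg Subtype.val this)
    have hL : Projectivization.mk F _ h0 ∈ (lineInfty F).projectivization := by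
      rw [Submodule.mk_mem_projectivization_iff]
      exact hP.1
    exact ⟨_, hL, rationalPart_span_eq_spreadElement b hP hL (Projectivization.submodule_mk _ _)⟩

/-- The span of the conjugates of `P` has dimension at most 3 and contains the extension of `[L]`,
of dimension 3. So `P` lies in that extension, on which the `τ`-coordinates are multiples of `τ(ℓ)`.
-/
theorem exists_conjCoords_eq_smul [Finite K] {P : Fin 7 → F} {L : ℙ F (Fin 3 → F)}
    (hL : L ∈ (lineInfty F).projectivization)
    (h : rationalPart K (Submodule.span F {P, conj K P, conj K (conj K P)}) = spreadElement b L)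
    {ℓ : Fin 3 → F} (hℓ : ℓ ∈ L.submodule) (hℓ0 : ℓ ≠ 0) (τ : F ≃ₐ[K] F) :
    ∃ c : F, conjCoords b τ P = c • fun i => τ (ℓ i) := by
  have hℓ2 : ℓ 2 = 0 := by
    rw [Submodule.mem_projectivization_iff_submodule_le] at hL
    exact hL hℓ
  -- The vectors corresponding to `bⱼ ℓ` form a `K`-basis of `[L]`.
  let v : Fin 3 → Fin 7 → K := fun j => sigma b (b j * ℓ 0) (b j * ℓ 1) 0
  have hv : ∀ j, planeCoords b (v j) = b j • ℓ := by
    intro j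
    rw [planeCoords_sigma]
    ext i; fin_cases i <;> simp [hℓ2]
  have hvτ : ∀ τ j, conjCoords b τ (embed F (v j)) = fun i => τ (b j) * τ (ℓ i) := by
    intro τ j
    rw [conjCoords_embed, hv]
    simp
  have hli : LinearIndependent F fun j => embed F (v j) := by
    rw [Fintype.linearIndependent_iff]
    intro x hx
    obtain ⟨i, hi⟩ := Function.ne_iff.1 hℓ0
    have := (existsUnique_conj_coords b 0).unique (y₁ := x) (y₂ := 0) (fun τ => ?_) (by simp)
    · exact fun j => congrFun this j
    · have h0 := congrArg (conjCoords b τ) hx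
      simp only [map_add, map_smul, hvτ, Fin.sum_univ_three, map_zero] at h0
      have h1 := congrFun h0 i
      have h2 : τ (ℓ i) ≠ 0 := by simpa using hi
      apply mul_right_cancel₀ h2
      simp at h1
      simp only [Pi.zero_apply, zero_mul]
      linear_combination h1
  have hle : Submodule.span F (Set.range fun j => embed F (v j)) ≤
      Submodule.span F {P, conj K P, conj K (conj K P)} := by
    rw [Submodule.span_le]
    rintro _ ⟨j, rfl⟩
    have : v j ∈ spreadElement b L := by
      rw [mem_spreadElement b hL, hv]
      exact L.submodule.smul_mem _ hℓ
    rw [← h] at this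
    exact this
  have hfin : Module.finrank F (Submodule.span F {P, conj K P, conj K (conj K P)}) ≤ 3 := by
    classical
    have hs : ({P, conj K P, conj K (conj K P)} : Set (Fin 7 → F)) =
        (({P, conj K P, conj K (conj K P)} : Finset (Fin 7 → F)) : Set (Fin 7 → F)) := by simp
    change Set.finrank F _ ≤ 3
    rw [hs]
    exact (finrank_span_finset_le_card _).trans Finset.card_le_three
  have heq := Submodule.eq_of_le_of_finrank_le hle (by
    rw [finrank_span_eq_card hli]
    simpa using hfin)
  have hP : P ∈ Submodule.span F (Set.range fun j => embed F (v j)) := by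
    rw [heq]
    exact Submodule.subset_span (by simp)
  have hle' : Submodule.span F (Set.range fun j => embed F (v j)) ≤
      (Submodule.span F {fun i => τ (ℓ i)}).comap (conjCoords b τ) := by
    rw [Submodule.span_le]
    rintro _ ⟨j, rfl⟩
    rw [SetLike.mem_coe, Submodule.mem_comap, Submodule.mem_span_singleton]
    exact ⟨τ (b j), by rw [hvτ]; rfl⟩
  obtain ⟨c, hc⟩ := Submodule.mem_span_singleton.1 (hle' hP)
  exact ⟨c, hc.symm⟩

theorem exists_mem_conjCoords_eq_smul [Finite K] {g : Submodule F (Fin 7 → F)}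
    (hg : IsTransversal b g) {ℓ : Fin 3 → F} (hℓ : ℓ ∈ lineInfty F) (hℓ0 : ℓ ≠ 0) :
    ∃ P ∈ g, P ≠ 0 ∧ ∀ τ : F ≃ₐ[K] F, ∃ c : F, conjCoords b τ P = c • fun i => τ (ℓ i) := by
  have hL : Projectivization.mk F ℓ hℓ0 ∈ (lineInfty F).projectivization := by
    rwa [Submodule.mk_mem_projectivization_iff]
  have hs : spreadElement b (Projectivization.mk F ℓ hℓ0) ∈ spread b := ⟨_, hL, rfl⟩
  rw [hg.2.2.2] at hs
  obtain ⟨P, hP, hP0, h⟩ := hs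
  refine ⟨P, hP, hP0, fun τ => exists_conjCoords_eq_smul b hL h.symm ?_ hℓ0 τ⟩
  rw [Projectivization.submodule_mk]
  exact Submodule.mem_span_singleton_self ℓ

theorem linearIndependent_of_conjCoords {τ : F ≃ₐ[K] F} {P Q : Fin 7 → F} {x y c d : F}
    (hc : c ≠ 0) (hd : d ≠ 0) (hxy : x ≠ y)
    (hP : conjCoords b τ P = c • fun i => τ (![1, x, 0] i))
    (hQ : conjCoords b τ Q = d • fun i => τ (![1, y, 0] i)) {s t : F}
    (h : conjCoords b τ (s • P + t • Q) = 0) : s = 0 ∧ t = 0 := by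
  rw [map_add, map_smul, map_smul, hP, hQ] at h
  have h0 := congrFun h 0
  have h1 := congrFun h 1
  simp at h0 h1
  have hne : τ x - τ y ≠ 0 := by
    rw [sub_ne_zero]; exact fun h => hxy (τ.injective h)
  have hs : s * c * (τ x - τ y) = 0 := by linear_combination h1 - τ y * h0
  have hs : s = 0 := by simpa [hc, hne] using hs
  subst hs
  simpa [hd] using h0

/-- Pigeonhole: each of the `q³ ≥ 8` points `(1, x, 0)` gives a point of `g` with nonzero
`τ`-coordinates for some `τ`, and there are only three `τ`. Two points sharing the same `τ` span
`g`, and their `τ`-coordinates are independent. -/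
theorem exists_injOn_conjCoords [Finite K] {g : Submodule F (Fin 7 → F)}
    (hg : IsTransversal b g) :
    ∃ τ : F ≃ₐ[K] F, ∀ P ∈ g, conjCoords b τ P = 0 → P = 0 := by
  have hF := finrank_eq_three b
  have hfd : Module.Finite K F := Module.Finite.of_basis b
  have hfin : Finite F := Module.finite_of_finite K
  choose P hPg hP0 c hc using fun x : F => exists_mem_conjCoords_eq_smul b hg
    (ℓ := ![1, x, 0]) rfl (fun h => by simpa using congrFun h 0)
  have hτ : ∀ x, ∃ τ : F ≃ₐ[K] F, c x τ ≠ 0 := by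
    intro x
    by_contra! h
    apply hP0 x
    apply eq_of_conjCoords_eq b
    intro τ
    rw [hc, h, zero_smul, map_zero]
  choose τ hτ using hτ
  have hninj : ¬ Function.Injective τ := by
    intro h
    have h1 := Nat.card_le_card_of_injective τ h
    rw [IsGalois.card_aut_eq_finrank, hF, Module.natCard_eq_pow_finrank (K := K), hF] at h1
    have h2 : 2 ^ 3 ≤ Nat.card K ^ 3 := Nat.pow_le_pow_left Finite.one_lt_card 3
    omega
  simp only [Function.Injective, not_forall] at hninj
  obtain ⟨x, y, hxy, hne⟩ := hninj
  have hQ := hτ y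
  rw [← hxy] at hQ
  have hind := fun s t => linearIndependent_of_conjCoords b (hτ x) hQ hne (hc x _) (hc y _)
    (s := s) (t := t)
  have hli : LinearIndependent F ![P x, P y] := by
    rw [LinearIndependent.pair_iff]
    intro s t h
    exact hind s t (by rw [h, map_zero])
  have hspan : Submodule.span F (Set.range ![P x, P y]) = g := by
    apply Submodule.eq_of_le_of_finrank_eq
    · rw [Submodule.span_le]
      rintro _ ⟨i, rfl⟩
      fin_cases i
      · exact hPg x
      · exact hPg y
    · rw [finrank_span_eq_card hli, hg.1]; rfl
  refine ⟨τ x, fun Q hQ h => ?_⟩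
  rw [← hspan, Matrix.range_cons, Matrix.range_cons, Matrix.range_empty, Set.union_empty,
    Set.singleton_union, Submodule.mem_span_pair] at hQ
  obtain ⟨s, t, rfl⟩ := hQ
  obtain ⟨rfl, rfl⟩ := hind s t h
  simp

/-- By injectivity, points of `g` are determined by their `τ`-coordinates. The remaining
`κ`-coordinates of `g` must vanish, since otherwise `κ = τ`. -/
theorem IsTransversal.exists_transversal_le [Finite K] {g : Submodule F (Fin 7 → F)}
    (hg : IsTransversal b g) : ∃ τ : F ≃ₐ[K] F, transversal b τ ≤ g := by
  obtain ⟨τ, hτ⟩ := exists_injOn_conjCoords b hg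
  refine ⟨τ, ?_⟩
  have key : ∀ ℓ ∈ lineInfty F, ℓ ≠ 0 → ∃ P ∈ g, conjCoords b τ P = (fun i => τ (ℓ i)) ∧
      ∀ κ : F ≃ₐ[K] F, ∃ c : F, conjCoords b κ P = c • fun i => κ (ℓ i) := by
    intro ℓ hℓ hℓ0
    obtain ⟨P, hPg, hP0, h⟩ := exists_mem_conjCoords_eq_smul b hg hℓ hℓ0
    choose c hc using h
    have hcτ : c τ ≠ 0 := by
      intro h0
      exact hP0 (hτ P hPg (by rw [hc, h0, zero_smul]))
    refine ⟨(c τ)⁻¹ • P, g.smul_mem _ hPg, ?_, fun κ => ⟨(c τ)⁻¹ * c κ, ?_⟩⟩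
    · rw [map_smul, hc, smul_smul, inv_mul_cancel₀ hcτ, one_smul]
    · rw [map_smul, hc, smul_smul]
  obtain ⟨P, hPg, hP, hPc⟩ := key ![1, 0, 0] rfl (fun h => by simpa using congrFun h 0)
  obtain ⟨Q, hQg, hQ, hQc⟩ := key ![0, 1, 0] rfl (fun h => by simpa using congrFun h 1)
  have hzero : ∀ κ : F ≃ₐ[K] F, κ ≠ τ → conjCoords b κ P = 0 ∧ conjCoords b κ Q = 0 := by
    intro κ hκ
    obtain ⟨d, hd⟩ := hPc κ
    obtain ⟨e, he⟩ := hQc κ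
    -- The point `R` above `(1, x, 0)` is `P + τ(x) Q`, so its `κ`-coordinates `(d, e τ(x), 0)` are
    -- proportional to `(1, κ(x), 0)`.
    have hx : ∀ x, e * τ x = d * κ x := by
      intro x
      obtain ⟨R, hRg, hR, hRc⟩ := key ![1, x, 0] rfl (fun h => by simpa using congrFun h 0)
      have hRPQ : R - (P + τ x • Q) = 0 := by
        apply hτ _ (g.sub_mem hRg (g.add_mem hPg (g.smul_mem _ hQg)))
        rw [map_sub, map_add, map_smul, hP, hQ, hR]
        ext i; fin_cases i <;> simp
      obtain ⟨f, hf⟩ := hRc κ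
      rw [sub_eq_zero.1 hRPQ, map_add, map_smul, hd, he] at hf
      have h0 := congrFun hf 0
      have h1 := congrFun hf 1
      simp at h0 h1
      rw [h0]
      linear_combination h1
    have hed : e = d := by simpa using hx 1
    have hd0 : d = 0 := by
      by_contra h0
      apply hκ
      ext x
      have := hx x
      rw [hed] at this
      exact (mul_left_cancel₀ h0 this).symm
    subst hed
    subst hd0
    simp [hd, he]
  intro v hv
  have hv2 : conjCoords b τ v 2 = 0 := hv.1
  have : v = conjCoords b τ v 0 • P + conjCoords b τ v 1 • Q := by
    apply eq_of_conjCoords_eq b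
    intro κ
    rw [map_add, map_smul, map_smul]
    by_cases hκ : κ = τ
    · subst hκ
      rw [hP, hQ]
      ext i; fin_cases i <;> simp [hv2]
    · rw [(hzero κ hκ).1, (hzero κ hκ).2, hv.2 κ hκ]
      simp
  rw [this]
  exact g.add_mem (g.smul_mem _ hPg) (g.smul_mem _ hQg)

end Transversals

/-! ### Special cubics factor, and their tangents meet `[L]` in explicit points. -/

section SpecialCubics

variable {K F : Type*} [Field K] [Field F] [Algebra K F] (b : Module.Basis (Fin 3) K F)

/-- The parametrisation of the spread element `[L]` by `GF(q³)`, where `ℓ` spans `L`. -/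
noncomputable def spreadMap (ℓ : Fin 3 → F) : F →ₗ[K] (Fin 7 → K) where
  toFun x := sigma b (x * ℓ 0) (x * ℓ 1) 0
  map_add' x y := by
    ext i; fin_cases i <;> simp [sigma, add_mul]
  map_smul' c x := by
    ext i; fin_cases i <;> simp [sigma]

theorem planeCoords_spreadMap {ℓ : Fin 3 → F} (hℓ : ℓ 2 = 0) (x : F) :
    planeCoords b (spreadMap b ℓ x) = x • ℓ := by
  change planeCoords b (sigma b (x * ℓ 0) (x * ℓ 1) 0) = _
  rw [planeCoords_sigma]
  ext i; fin_cases i <;> simp [hℓ]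

theorem spreadMap_injective {ℓ : Fin 3 → F} (hℓ : ℓ 2 = 0) (hℓ0 : ℓ ≠ 0) :
    Function.Injective (spreadMap b ℓ) := by
  intro x y h
  have h := congrArg (planeCoords b) h
  rw [planeCoords_spreadMap b hℓ, planeCoords_spreadMap b hℓ] at h
  exact smul_left_injective F hℓ0 h

theorem range_spreadMap {L : ℙ F (Fin 3 → F)} (hL : L ∈ (lineInfty F).projectivization)
    {ℓ : Fin 3 → F} (hℓ : ℓ 2 = 0) (hLℓ : L.submodule = Submodule.span F {ℓ}) :
    LinearMap.range (spreadMap b ℓ) = spreadElement b L := by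
  ext v
  rw [mem_spreadElement b hL, hLℓ, Submodule.mem_span_singleton, LinearMap.mem_range]
  refine exists_congr fun x => ?_
  rw [← planeCoords_spreadMap b hℓ, (planeCoords_injective b).eq_iff]

theorem finrank_spreadElement {L : ℙ F (Fin 3 → F)} (hL : L ∈ (lineInfty F).projectivization) :
    Module.finrank K (spreadElement b L) = 3 := by
  have hℓ : L.rep 2 = 0 := by
    rw [Submodule.mem_projectivization_iff_submodule_le, L.submodule_eq,
      Submodule.span_singleton_le_iff_mem] at hL
    exact hL
  rw [← range_spreadMap b hL hℓ L.submodule_eq,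
    LinearMap.finrank_range_of_inj (spreadMap_injective b hℓ L.rep_nonzero), finrank_eq_three b]

theorem finrank_hyperplaneInfty : Module.finrank K (hyperplaneInfty K) = 6 := by
  have h := LinearMap.finrank_range_add_finrank_ker (LinearMap.proj 6 : (Fin 7 → K) →ₗ[K] K)
  have hs : LinearMap.range (LinearMap.proj 6 : (Fin 7 → K) →ₗ[K] K) = ⊤ :=
    LinearMap.range_eq_top.2 (LinearMap.proj_surjective 6)
  rw [hs] at h
  simp at h
  rw [hyperplaneInfty]
  omega

theorem finrank_span_inf_hyperplaneInfty {c : Fin 4 → Fin 7 → K} (hc : LinearIndependent K c)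
    (hcH : ¬ Submodule.span K (Set.range c) ≤ hyperplaneInfty K) :
    Module.finrank K (Submodule.span K (Set.range c) ⊓ hyperplaneInfty K : Submodule K _) = 3 := by
  have h4 : Module.finrank K (Submodule.span K (Set.range c)) = 4 := by
    rw [finrank_span_eq_card hc]; rfl
  have h1 := Submodule.finrank_sup_add_finrank_inf_eq (Submodule.span K (Set.range c))
    (hyperplaneInfty K)
  have h2 := Submodule.finrank_le (Submodule.span K (Set.range c) ⊔ hyperplaneInfty K)
  have h3 := Submodule.finrank_lt_finrank_of_lt (inf_lt_left.2 hcH)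
  rw [h4, finrank_hyperplaneInfty] at h1
  rw [Module.finrank_fin_fun] at h2
  omega

theorem spreadElement_le_hyperplaneInfty {L : ℙ F (Fin 3 → F)} :
    spreadElement b L ≤ hyperplaneInfty K := by
  rw [spreadElement, Submodule.span_le]
  rintro _ ⟨α, β, h, rfl⟩
  rfl

/-- In plane coordinates, the cubic curve `c` is
`(s a + t d) (s + δ^q t) (s + δ^(q²) t)`, where `s a + t d` runs over an order-`q`-subline and
the last coordinate of `s a + t d` is a multiple of `s + δ t`. -/
structure Factors (φ : F ≃ₐ[K] F) (c : Fin 4 → Fin 7 → K) (δ : F) (a d : Fin 3 → F) : Prop where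
  zero : ∀ i, planeCoords b (c 0) i = a i
  one : ∀ i, planeCoords b (c 1) i = d i + (φ δ + φ (φ δ)) * a i
  two : ∀ i, planeCoords b (c 2) i = (φ δ + φ (φ δ)) * d i + φ δ * φ (φ δ) * a i
  three : ∀ i, planeCoords b (c 3) i = φ δ * φ (φ δ) * d i
  last : d 2 = δ * a 2

/-- This is the division of `A₀X³ + A₁X² + A₂X + A₃` by `(X + u)(X + w)`, with quotient `A₀X + (A₁ -
(u + w)A₀)`. -/
theorem coeffs_of_two_roots {u w A₀ A₁ A₂ A₃ : F} (huw : u ≠ w)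
    (hu : A₀ * (-u) ^ 3 + A₁ * (-u) ^ 2 + A₂ * (-u) + A₃ = 0)
    (hw : A₀ * (-w) ^ 3 + A₁ * (-w) ^ 2 + A₂ * (-w) + A₃ = 0) :
    A₂ = (u + w) * (A₁ - (u + w) * A₀) + u * w * A₀ ∧
      A₃ = u * w * (A₁ - (u + w) * A₀) := by
  have h2 : A₂ = (u + w) * (A₁ - (u + w) * A₀) + u * w * A₀ := by
    apply mul_left_cancel₀ (sub_ne_zero.2 huw)
    linear_combination hw - hu
  refine ⟨h2, ?_⟩
  linear_combination hu + u * h2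

theorem exists_norm {φ : F ≃ₐ[K] F} (hφ : IsCubicFrobenius φ) (δ : F) (s t : K) :
    ∃ n : K, algebraMap K F n = (algebraMap K F s + algebraMap K F t * δ) *
      ((algebraMap K F s + algebraMap K F t * φ δ) *
      (algebraMap K F s + algebraMap K F t * φ (φ δ))) := by
  apply hφ.exists_of_fixed
  simp only [map_mul, map_add, AlgEquiv.commutes, hφ.apply_cube]
  ring

theorem IsCubicFrobenius.notMem_range {φ : F ≃ₐ[K] F} (_ : IsCubicFrobenius φ) {δ : F}
    (hδ : δ ∉ Set.range (algebraMap K F)) :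
    φ δ ∉ Set.range (algebraMap K F) := by
  rintro ⟨k, hk⟩
  apply hδ
  refine ⟨k, ?_⟩
  apply φ.injective
  rw [← hk, AlgEquiv.commutes]

theorem IsCubicFrobenius.apply_ne {φ : F ≃ₐ[K] F} (hφ : IsCubicFrobenius φ) {δ : F}
    (hδ : δ ∉ Set.range (algebraMap K F)) : φ δ ≠ δ :=
  fun h => hδ (hφ.exists_of_fixed δ h)

theorem IsCubicFrobenius.apply_apply_ne {φ : F ≃ₐ[K] F} (hφ : IsCubicFrobenius φ) {δ : F}
    (hδ : δ ∉ Set.range (algebraMap K F)) : φ (φ δ) ≠ δ := by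
  intro h
  apply hφ.apply_ne hδ
  have := congrArg φ h
  rw [hφ.apply_cube] at this
  exact this.symm

namespace Factors

variable {b} {φ : F ≃ₐ[K] F} {c : Fin 4 → Fin 7 → K} {δ : F} {a d : Fin 3 → F}

theorem planeCoords_cubic (h : Factors b φ c δ a d) (s t : K) :
    planeCoords b (cubic c s t) = ((algebraMap K F s + algebraMap K F t * φ δ) *
      (algebraMap K F s + algebraMap K F t * φ (φ δ))) •
      (algebraMap K F s • a + algebraMap K F t • d) := by
  ext i
  simp only [cubic, map_add, planeCoords_smul, Pi.add_apply, Pi.smul_apply,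
    h.zero, h.one, h.two, h.three, smul_eq_mul, map_mul, map_pow]
  ring

theorem cubic_apply_six (hφ : IsCubicFrobenius φ) (h : Factors b φ c δ a d)
    (hδ : δ ∉ Set.range (algebraMap K F)) (ha : a 2 ≠ 0) {s t : K} (hst : (s, t) ≠ (0, 0)) :
    cubic c s t 6 ≠ 0 := by
  intro h0
  have h1 := congrFun (h.planeCoords_cubic s t) 2
  rw [planeCoords_apply_two, h0] at h1
  have hδ₁ := hφ.notMem_range hδ
  simp only [map_zero, Pi.smul_apply, Pi.add_apply, smul_eq_mul, h.last] at h1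
  have h2 := mul_ne_zero (mul_ne_zero (add_mul_ne_zero hδ₁ hst)
    (add_mul_ne_zero (hφ.notMem_range hδ₁) hst)) (mul_ne_zero (add_mul_ne_zero hδ hst) ha)
  apply h2
  rw [h1]
  ring

/-- The curve is `N v` with `N` the norm of `s + δt` and `v = (s a + t d)/(s + δt)`, whose last
coordinate is constant. In the direction `(y, z)` the derivative is `(DN) v + N Dv`, so the
combination with last coordinate zero is `N Dv`, where `Dv = (zs - yt)(d - δa)/(s + δt)²`. -/
theorem planeCoords_tangent (h : Factors b φ c δ a d)
    (hδ : δ ∉ Set.range (algebraMap K F)) (ha : a 2 ≠ 0) {s t : K} (hst : (s, t) ≠ (0, 0))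
    {n : K} (hn : algebraMap K F n = (algebraMap K F s + algebraMap K F t * δ) *
      ((algebraMap K F s + algebraMap K F t * φ δ) *
      (algebraMap K F s + algebraMap K F t * φ (φ δ)))) (x y z : K)
    (h6 : (x • cubic c s t + y • ((3 * s ^ 2) • c 0 + (2 * s * t) • c 1 + t ^ 2 • c 2) +
      z • (s ^ 2 • c 1 + (2 * s * t) • c 2 + (3 * t ^ 2) • c 3)) 6 = 0) :
    planeCoords b (x • cubic c s t +
      y • ((3 * s ^ 2) • c 0 + (2 * s * t) • c 1 + t ^ 2 • c 2) +
      z • (s ^ 2 • c 1 + (2 * s * t) • c 2 + (3 * t ^ 2) • c 3)) =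
    (algebraMap K F ((z * s - y * t) * n) / (algebraMap K F s + algebraMap K F t * δ) ^ 2) •
      (d - δ • a) := by
  set v := x • cubic c s t + y • ((3 * s ^ 2) • c 0 + (2 * s * t) • c 1 + t ^ 2 • c 2) +
      z • (s ^ 2 • c 1 + (2 * s * t) • c 2 + (3 * t ^ 2) • c 3) with hv
  have hw := add_mul_ne_zero hδ hst
  have h2 : planeCoords b v 2 = 0 := by rw [planeCoords_apply_two, h6, map_zero]
  ext i
  have hc : ∀ i, planeCoords b v i = algebraMap K F x *
      (((algebraMap K F s + algebraMap K F t * φ δ) *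
      (algebraMap K F s + algebraMap K F t * φ (φ δ))) *
      (algebraMap K F s * a i + algebraMap K F t * d i)) +
      algebraMap K F y * (3 * algebraMap K F s ^ 2 * a i + 2 * algebraMap K F s * algebraMap K F t *
        (d i + (φ δ + φ (φ δ)) * a i) + algebraMap K F t ^ 2 *
        ((φ δ + φ (φ δ)) * d i + φ δ * φ (φ δ) * a i)) +
      algebraMap K F z * (algebraMap K F s ^ 2 * (d i + (φ δ + φ (φ δ)) * a i) +
        2 * algebraMap K F s * algebraMap K F t *
        ((φ δ + φ (φ δ)) * d i + φ δ * φ (φ δ) * a i) + 3 * algebraMap K F t ^ 2 *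
        (φ δ * φ (φ δ) * d i)) := by
    intro i
    simp only [hv, map_add, planeCoords_smul, Pi.add_apply, Pi.smul_apply, h.planeCoords_cubic,
      h.zero, h.one, h.two, h.three, smul_eq_mul, map_mul, map_pow, map_ofNat]
  rw [hc, h.last] at h2
  rw [hc, Pi.smul_apply, smul_eq_mul, map_mul, hn, map_sub, map_mul, map_mul]
  simp only [Pi.sub_apply, Pi.smul_apply, smul_eq_mul]
  have h3 : ∀ p q r w : F, w ≠ 0 → p * (w * q) / w ^ 2 * r * (w * a 2) = p * q * r * a 2 := by
    intro p q r w hw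
    field_simp
  -- After multiplication by `(s + δt) a₂`, the vanishing last coordinate `h2` eliminates `x`.
  apply mul_right_cancel₀ (mul_ne_zero hw ha)
  rw [h3 _ _ _ _ hw]
  linear_combination (algebraMap K F s * a i + algebraMap K F t * d i) * h2

theorem tangentLine_inf_spreadElement (hφ : IsCubicFrobenius φ) (h : Factors b φ c δ a d)
    (hδ : δ ∉ Set.range (algebraMap K F)) (ha : a 2 ≠ 0)
    {L : ℙ F (Fin 3 → F)} (hL : L ∈ (lineInfty F).projectivization)
    {ℓ : Fin 3 → F} (hℓ : ℓ 2 = 0) (hLℓ : L.submodule = Submodule.span F {ℓ}) {ρ : F}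
    (hρ : d - δ • a = ρ • ℓ) {s t : K} (hst : (s, t) ≠ (0, 0)) :
    tangentLine c s t ⊓ spreadElement b L = Submodule.span K
      {spreadMap b ℓ (ρ / (algebraMap K F s + algebraMap K F t * δ) ^ 2)} := by
  obtain ⟨n, hn⟩ := exists_norm hφ δ s t
  have key : ∀ x y z : K, (x • cubic c s t +
      y • ((3 * s ^ 2) • c 0 + (2 * s * t) • c 1 + t ^ 2 • c 2) +
      z • (s ^ 2 • c 1 + (2 * s * t) • c 2 + (3 * t ^ 2) • c 3)) 6 = 0 →
      x • cubic c s t + y • ((3 * s ^ 2) • c 0 + (2 * s * t) • c 1 + t ^ 2 • c 2) +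
      z • (s ^ 2 • c 1 + (2 * s * t) • c 2 + (3 * t ^ 2) • c 3) =
      ((z * s - y * t) * n) •
      spreadMap b ℓ (ρ / (algebraMap K F s + algebraMap K F t * δ) ^ 2) := by
    intro x y z h6
    apply planeCoords_injective b
    rw [h.planeCoords_tangent hδ ha hst hn x y z h6, ← map_smul, planeCoords_spreadMap b hℓ,
      hρ, smul_smul]
    congr 1
    rw [Algebra.smul_def]
    ring
  have hn0 : n ≠ 0 := by
    rintro rfl
    rw [map_zero] at hn
    have hδ₁ := hφ.notMem_range hδ
    exact mul_ne_zero (add_mul_ne_zero hδ hst) (mul_ne_zero (add_mul_ne_zero hδ₁ hst)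
      (add_mul_ne_zero (hφ.notMem_range hδ₁) hst)) hn.symm
  apply le_antisymm
  · rintro v ⟨hv, hvL⟩
    obtain ⟨x, y, z, rfl⟩ := Submodule.mem_span_triple.1 hv
    rw [key x y z (spreadElement_le_hyperplaneInfty b hvL)]
    exact Submodule.smul_mem _ _ (Submodule.mem_span_singleton_self _)
  · rw [Submodule.span_singleton_le_iff_mem]
    refine ⟨?_, ?_⟩
    · obtain ⟨y, z, hyz⟩ : ∃ y z : K, (z * s - y * t) * n = 1 := by
        by_cases hs : s = 0
        · have ht : t ≠ 0 := by rintro rfl; exact hst (by rw [hs])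
          exact ⟨-(t * n)⁻¹, 0, by field_simp; ring⟩
        · exact ⟨0, (s * n)⁻¹, by field_simp; ring⟩
      have h6 := h.cubic_apply_six hφ hδ ha hst
      -- The coefficient of the curve point is chosen to cancel the last coordinate.
      have := key (-((y • ((3 * s ^ 2) • c 0 + (2 * s * t) • c 1 + t ^ 2 • c 2) +
        z • (s ^ 2 • c 1 + (2 * s * t) • c 2 + (3 * t ^ 2) • c 3)) 6) / cubic c s t 6) y z (by
          simp only [Pi.add_apply, Pi.smul_apply, smul_eq_mul]
          field_simp
          ring)
      rw [hyz, one_smul] at this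
      rw [← this]
      exact Submodule.mem_span_triple.2 ⟨_, y, z, rfl⟩
    · rw [← range_spreadMap b hL hℓ hLℓ]
      exact LinearMap.mem_range_self _ _

end Factors

/-- The points `⟨ρ w⁻² ℓ⟩` of `[L]`, where `w` runs over the non-zero vectors of `W`. -/
noncomputable def squarePoints (ℓ : Fin 3 → F) (W : Submodule K F) (ρ : F) :
    Set (ℙ K (Fin 7 → K)) :=
  {Q | ∃ w ∈ W, w ≠ 0 ∧ Q.submodule = Submodule.span K {spreadMap b ℓ (ρ / w ^ 2)}}

theorem submodule_le_span_singleton_iff {k V : Type*} [Field k] [AddCommGroup V] [Module k V]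
    (Q : ℙ k V) (v : V) : Q.submodule ≤ Submodule.span k {v} ↔
      Q.submodule = Submodule.span k {v} := by
  refine ⟨fun h => Submodule.eq_of_le_of_finrank_le h ?_, fun h => h.le⟩
  rw [Q.finrank_submodule]
  exact (finrank_span_le_card {v}).trans (by simp)

theorem Factors.shadowPoints_eq {b} {φ : F ≃ₐ[K] F} {c : Fin 4 → Fin 7 → K} {δ : F}
    {a d : Fin 3 → F} (hφ : IsCubicFrobenius φ) (h : Factors b φ c δ a d)
    (hδ : δ ∉ Set.range (algebraMap K F)) (ha : a 2 ≠ 0)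
    {L : ℙ F (Fin 3 → F)} (hL : L ∈ (lineInfty F).projectivization)
    {ℓ : Fin 3 → F} (hℓ : ℓ 2 = 0) (hLℓ : L.submodule = Submodule.span F {ℓ}) {ρ : F}
    (hρ : d - δ • a = ρ • ℓ) :
    shadowPoints b L c = squarePoints b ℓ (pencil K δ) ρ := by
  ext Q
  constructor
  · rintro ⟨s, t, hst, hQ⟩
    rw [h.tangentLine_inf_spreadElement hφ hδ ha hL hℓ hLℓ hρ hst,
      submodule_le_span_singleton_iff] at hQ
    exact ⟨_, mem_pencil.2 ⟨s, t, rfl⟩, add_mul_ne_zero hδ hst, hQ⟩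
  · rintro ⟨w, hw, hw0, hQ⟩
    obtain ⟨s, t, rfl⟩ := mem_pencil.1 hw
    have hst : (s, t) ≠ (0, 0) := by
      intro h
      simp only [Prod.mk.injEq] at h
      exact hw0 (by simp [h])
    refine ⟨s, t, hst, ?_⟩
    rw [h.tangentLine_inf_spreadElement hφ hδ ha hL hℓ hLℓ hρ hst, hQ]

theorem conjCoords_cubic_embed (τ : F ≃ₐ[K] F) (c : Fin 4 → Fin 7 → K) (s t : F) (i : Fin 3) :
    conjCoords b τ (cubic (fun j => embed F (c j)) s t) i =
      τ (planeCoords b (c 0) i) * s ^ 3 + τ (planeCoords b (c 1) i) * (s ^ 2 * t) +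
      τ (planeCoords b (c 2) i) * (s * t ^ 2) + τ (planeCoords b (c 3) i) * t ^ 3 := by
  simp only [cubic, map_add, map_smul, Pi.add_apply, Pi.smul_apply, conjCoords_embed, smul_eq_mul]
  ring

/-- The cubic meets `transversal b 1` at a parameter `(-δ, 1)`, up to scaling. There the `φ`- and
`φ²`-coordinates vanish; applying `φ²` and `φ` respectively turns these equations into roots of the
plane coordinates. The last coordinate also vanishes, because the transversal lies at infinity. -/
theorem IsSpecialCubic.exists_root [Finite K] {L : ℙ F (Fin 3 → F)} {c : Fin 4 → Fin 7 → K}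
    (hc : IsSpecialCubic b L c) {φ : F ≃ₐ[K] F} (hφ : IsCubicFrobenius φ) :
    ∃ δ : F, δ ∉ Set.range (algebraMap K F) ∧
      (∀ i, planeCoords b (c 0) i * (-φ δ) ^ 3 + planeCoords b (c 1) i * (-φ δ) ^ 2 +
        planeCoords b (c 2) i * (-φ δ) + planeCoords b (c 3) i = 0) ∧
      (∀ i, planeCoords b (c 0) i * (-φ (φ δ)) ^ 3 + planeCoords b (c 1) i * (-φ (φ δ)) ^ 2 +
        planeCoords b (c 2) i * (-φ (φ δ)) + planeCoords b (c 3) i = 0) ∧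
      planeCoords b (c 0) 2 * (-δ) ^ 3 + planeCoords b (c 1) 2 * (-δ) ^ 2 +
        planeCoords b (c 2) 2 * (-δ) + planeCoords b (c 3) 2 = 0 := by
  have hF := finrank_eq_three b
  have hli := hc.1
  obtain ⟨s, t, hst, h6, hker⟩ := hc.2.2.2 _ (isTransversal_transversal b)
  have h1 := hker φ (hφ.ne_one hF)
  have h2 := hker (φ * φ) (hφ.mul_self_ne_one hF)
  have ht : t ≠ 0 := by
    rintro rfl
    have hs : s ≠ 0 := by rintro rfl; exact hst rfl
    apply hli.ne_zero 0
    apply planeCoords_injective b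
    ext i
    have := congrFun h1 i
    rw [conjCoords_cubic_embed] at this
    simpa [hs] using this
  obtain ⟨δ, rfl⟩ : ∃ δ, s = -δ * t := ⟨-s / t, by field_simp⟩
  have r1 : ∀ i, φ (planeCoords b (c 0) i) * (-δ) ^ 3 + φ (planeCoords b (c 1) i) * (-δ) ^ 2 +
      φ (planeCoords b (c 2) i) * (-δ) + φ (planeCoords b (c 3) i) = 0 := by
    intro i
    have := congrFun h1 i
    rw [conjCoords_cubic_embed, Pi.zero_apply] at this
    apply mul_right_cancel₀ (pow_ne_zero 3 ht)
    linear_combination this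
  have r2 : ∀ i, φ (φ (planeCoords b (c 0) i)) * (-δ) ^ 3 +
      φ (φ (planeCoords b (c 1) i)) * (-δ) ^ 2 +
      φ (φ (planeCoords b (c 2) i)) * (-δ) + φ (φ (planeCoords b (c 3) i)) = 0 := by
    intro i
    have := congrFun h2 i
    rw [conjCoords_cubic_embed, Pi.zero_apply] at this
    simp only [AlgEquiv.mul_apply] at this
    apply mul_right_cancel₀ (pow_ne_zero 3 ht)
    linear_combination this
  refine ⟨δ, ?_, ?_, ?_, ?_⟩
  -- If `δ` were in `K`, the cubic would take the value zero at a rational parameter, a dependence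
  -- among the `c j`.
  · rintro ⟨k, rfl⟩
    have h0 : (-k) ^ 3 • c 0 + (-k) ^ 2 • c 1 + (-k) • c 2 + (1 : K) • c 3 = 0 := by
      apply planeCoords_injective b
      ext i
      apply φ.injective
      simp only [map_add, planeCoords_smul, Pi.add_apply, map_mul,
        AlgEquiv.commutes, map_pow, map_neg, map_zero, map_one, Pi.zero_apply]
      linear_combination r1 i
    have := Fintype.linearIndependent_iff.1 hli ![(-k) ^ 3, (-k) ^ 2, -k, 1] (by
      simpa [Fin.sum_univ_four] using h0) 3
    simp at this
  · intro i
    have := congrArg φ (r2 i)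
    simpa only [map_add, map_mul, map_pow, map_neg, hφ.apply_cube, map_zero] using this
  · intro i
    have := congrArg (fun x => φ (φ x)) (r1 i)
    simpa only [map_add, map_mul, map_pow, map_neg, hφ.apply_cube, map_zero] using this
  · simp only [planeCoords_apply_two]
    apply mul_right_cancel₀ (pow_ne_zero 3 ht)
    have : cubic (fun j => embed F (c j)) (-δ * t) t 6 = 0 := h6
    simp only [cubic, Pi.add_apply, Pi.smul_apply, embed, smul_eq_mul] at this
    linear_combination this

theorem IsSpecialCubic.exists_factors [Finite K] {L : ℙ F (Fin 3 → F)}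
    (hL : L ∈ (lineInfty F).projectivization) {ℓ : Fin 3 → F}
    (hLℓ : L.submodule = Submodule.span F {ℓ}) {c : Fin 4 → Fin 7 → K}
    (hc : IsSpecialCubic b L c) {φ : F ≃ₐ[K] F} (hφ : IsCubicFrobenius φ) :
    ∃ (δ ρ : F) (a d : Fin 3 → F), δ ∉ Set.range (algebraMap K F) ∧ ρ ≠ 0 ∧ a 2 ≠ 0 ∧
      Factors b φ c δ a d ∧ d - δ • a = ρ • ℓ := by
  obtain ⟨δ, hδ, r1, r2, r0⟩ := hc.exists_root b hφ
  have hli := hc.1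
  have hne : φ δ ≠ φ (φ δ) := fun h => hφ.apply_ne hδ (φ.injective h).symm
  have hr := fun i => coeffs_of_two_roots hne (r1 i) (r2 i)
  set a : Fin 3 → F := planeCoords b (c 0) with ha
  set d : Fin 3 → F := fun i => planeCoords b (c 1) i - (φ δ + φ (φ δ)) * a i with hd
  have h1 : ∀ i, planeCoords b (c 1) i = d i + (φ δ + φ (φ δ)) * a i := fun i => by
    rw [hd]; ring
  have h2 : ∀ i, planeCoords b (c 2) i = (φ δ + φ (φ δ)) * d i + φ δ * φ (φ δ) * a i :=
    fun i => (hr i).1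
  have h3 : ∀ i, planeCoords b (c 3) i = φ δ * φ (φ δ) * d i := fun i => (hr i).2
  have hlast : d 2 = δ * a 2 := by
    rw [h1, h2, h3] at r0
    have h0 : (d 2 - δ * a 2) * ((φ δ - δ) * (φ (φ δ) - δ)) = 0 := by linear_combination r0
    rw [mul_eq_zero, or_iff_left (mul_ne_zero (sub_ne_zero.2 (hφ.apply_ne hδ))
      (sub_ne_zero.2 (hφ.apply_apply_ne hδ)))] at h0
    linear_combination h0
  have hfac : Factors b φ c δ a d := ⟨fun i => rfl, h1, h2, h3, hlast⟩
  have ha2 : a 2 ≠ 0 := by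
    intro h0
    apply hc.2.2.1
    rw [Submodule.span_le]
    rintro _ ⟨j, rfl⟩
    have hj : planeCoords b (c j) 2 = 0 := by
      fin_cases j
      · exact h0
      · simp [h1, hlast, h0]
      · simp [h2, hlast, h0]
      · simp [h3, hlast, h0]
    rw [planeCoords_apply_two] at hj
    exact (map_eq_zero _).1 hj
  have hinf : Submodule.span K (Set.range c) ⊓ hyperplaneInfty K = spreadElement b L := by
    symm
    apply Submodule.eq_of_le_of_finrank_eq
    · exact le_inf hc.2.1 (spreadElement_le_hyperplaneInfty b)
    · rw [finrank_spreadElement b hL, finrank_span_inf_hyperplaneInfty hli hc.2.2.1]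
  have hv6 : (c 0 6 • c 1 - c 1 6 • c 0) 6 = 0 := by simp [mul_comm]
  -- This combination of `c 0` and `c 1` lies at infinity, hence in `[L]`; its plane coordinates are
  -- `a₂(d - δa)`, which puts `d - δa` in `L`.
  have hv : c 0 6 • c 1 - c 1 6 • c 0 ∈ spreadElement b L := by
    rw [← hinf]
    refine ⟨?_, hv6⟩
    exact Submodule.sub_mem _
      (Submodule.smul_mem _ _ (Submodule.subset_span ⟨1, rfl⟩))
      (Submodule.smul_mem _ _ (Submodule.subset_span ⟨0, rfl⟩))
  have hΦ : planeCoords b (c 0 6 • c 1 - c 1 6 • c 0) = a 2 • (d - δ • a) := by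
    ext i
    simp only [map_sub, planeCoords_smul, Pi.sub_apply, Pi.smul_apply, smul_eq_mul]
    rw [← planeCoords_apply_two b, ← planeCoords_apply_two b, h1 i, h1 2, hlast, ← ha]
    ring
  have hmem := (mem_spreadElement b hL).1 hv
  rw [hΦ, hLℓ] at hmem
  rw [Submodule.smul_mem_iff _ ha2] at hmem
  obtain ⟨ρ, hρ⟩ := Submodule.mem_span_singleton.1 hmem
  refine ⟨δ, ρ, a, d, hδ, ?_, ha2, hfac, hρ.symm⟩
  rintro rfl
  rw [← hρ, zero_smul, smul_zero, ← map_zero (planeCoords b)] at hΦ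
  have h0 := planeCoords_injective b hΦ
  have := Fintype.linearIndependent_iff.1 hli ![-c 1 6, c 0 6, 0, 0] (by
    simp [Fin.sum_univ_four]
    rw [← h0]
    abel) 1
  apply ha2
  rw [ha, planeCoords_apply_two]
  simpa using this

end SpecialCubics

/-! ### Every admissible pair `(δ, ρ)` comes from a subline on a given line. -/

section Sublines

variable {K F : Type*} [Field K] [Field F] [Algebra K F] (b : Module.Basis (Fin 3) K F)

theorem exists_planeCoords_eq {v : Fin 3 → F} {k : K} (h : algebraMap K F k = v 2) :
    ∃ c, planeCoords b c = v := by
  refine ⟨sigma b (v 0) (v 1) k, ?_⟩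
  rw [planeCoords_sigma, h]
  ext i; fin_cases i <;> rfl

/-- The last coordinates of the four coefficient vectors are the elementary symmetric functions of
`δ, φ δ, φ² δ`, so they lie in `K` and the vectors are rational. -/
theorem exists_factors {φ : F ≃ₐ[K] F} (hφ : IsCubicFrobenius φ) {δ : F} {a d : Fin 3 → F}
    (ha : a 2 = 1) (hd : d 2 = δ) : ∃ c, Factors b φ c δ a d := by
  have hcube := hφ.apply_cube
  obtain ⟨k₁, h₁⟩ := hφ.exists_of_fixed (δ + (φ δ + φ (φ δ))) (by
    simp only [map_add, hcube]; ring)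
  obtain ⟨k₂, h₂⟩ := hφ.exists_of_fixed ((φ δ + φ (φ δ)) * δ + φ δ * φ (φ δ)) (by
    simp only [map_add, map_mul, hcube]; ring)
  obtain ⟨k₃, h₃⟩ := hφ.exists_of_fixed (φ δ * φ (φ δ) * δ) (by
    simp only [map_mul, hcube]; ring)
  obtain ⟨c₀, hc₀⟩ := exists_planeCoords_eq b (v := a) (k := 1) (by simp [ha])
  obtain ⟨c₁, hc₁⟩ := exists_planeCoords_eq b (v := fun i => d i + (φ δ + φ (φ δ)) * a i)
    (k := k₁) (by simp [ha, hd, h₁])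
  obtain ⟨c₂, hc₂⟩ := exists_planeCoords_eq b
    (v := fun i => (φ δ + φ (φ δ)) * d i + φ δ * φ (φ δ) * a i) (k := k₂) (by simp [ha, hd, h₂])
  obtain ⟨c₃, hc₃⟩ := exists_planeCoords_eq b (v := fun i => φ δ * φ (φ δ) * d i)
    (k := k₃) (by simp [hd, h₃])
  exact ⟨![c₀, c₁, c₂, c₃], congrFun hc₀, congrFun hc₁, congrFun hc₂, congrFun hc₃,
    by rw [ha, hd, mul_one]⟩

namespace Factors

variable {b} {φ : F ≃ₐ[K] F} {c : Fin 4 → Fin 7 → K} {δ : F} {a d : Fin 3 → F}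

theorem planeCoords_sum (h : Factors b φ c δ a d) (x : Fin 4 → K) :
    planeCoords b (∑ j, x j • c j) =
      (algebraMap K F (x 0) + algebraMap K F (x 1) * (φ δ + φ (φ δ)) +
        algebraMap K F (x 2) * (φ δ * φ (φ δ))) • a +
      (algebraMap K F (x 1) + algebraMap K F (x 2) * (φ δ + φ (φ δ)) +
        algebraMap K F (x 3) * (φ δ * φ (φ δ))) • d := by
  ext i
  simp only [Fin.sum_univ_four, map_add, planeCoords_smul, Pi.add_apply, Pi.smul_apply,
    smul_eq_mul, h.zero, h.one, h.two, h.three]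
  ring

theorem add_smul_eq (h : Factors b φ c δ a d) (ha : a 2 ≠ 0) {x y : F}
    (hxy : (x • a + y • d) 2 = 0) : x = -(y * δ) ∧ x • a + y • d = y • (d - δ • a) := by
  have hx : x = -(y * δ) := by
    simp only [Pi.add_apply, Pi.smul_apply, smul_eq_mul, h.last] at hxy
    apply mul_right_cancel₀ ha
    linear_combination hxy
  refine ⟨hx, ?_⟩
  rw [hx]
  ext i
  simp
  ring

theorem linearIndependent (hφ : IsCubicFrobenius φ) (h : Factors b φ c δ a d)
    (hδ : δ ∉ Set.range (algebraMap K F)) (ha : a 2 ≠ 0) (hne : d - δ • a ≠ 0) :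
    LinearIndependent K c := by
  have hδ₁ := hφ.notMem_range hδ
  have hδ₂ := hφ.notMem_range hδ₁
  have hnz : ∀ {y : F}, y ∉ Set.range (algebraMap K F) → y ≠ 0 := by
    rintro y hy rfl
    exact hy ⟨0, map_zero _⟩
  rw [Fintype.linearIndependent_iff]
  intro x hx
  have h0 := h.planeCoords_sum x
  rw [hx, map_zero] at h0
  obtain ⟨h1, h2⟩ := h.add_smul_eq ha (congrFun h0.symm 2)
  rw [← h0, eq_comm, smul_eq_zero, or_iff_left hne] at h2
  rw [h2, zero_mul, neg_zero] at h1
  obtain ⟨tr, htr⟩ := hφ.exists_of_fixed (δ + φ δ + φ (φ δ)) (by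
    simp only [map_add, hφ.apply_cube]; ring)
  obtain ⟨n, hn⟩ := hφ.exists_of_fixed (δ * φ δ * φ (φ δ)) (by
    simp only [map_mul, hφ.apply_cube]; ring)
  have hn0 : n ≠ 0 := by
    rintro rfl
    rw [map_zero] at hn
    exact mul_ne_zero (mul_ne_zero (hnz hδ) (hnz hδ₁)) (hnz hδ₂) hn.symm
  -- Multiplying `h1` by `δ` replaces `φ δ + φ² δ` by trace minus `δ` and `φ δ · φ² δ` by the norm,
  -- leaving a quadratic relation in `δ` over `K`.
  obtain ⟨e2, e0, e1⟩ := quadratic_eq_zero (finrank_eq_three b) hδ (x₀ := x 2 * n)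
    (x₁ := x 0 + x 1 * tr) (x₂ := -x 1) (by
      simp only [map_mul, map_add, map_neg, htr, hn]
      linear_combination δ * h1)
  have e1 : x 1 = 0 := by simpa using e1
  have e0 : x 0 = 0 := by simpa [e1] using e0
  have e2 : x 2 = 0 := by simpa [hn0] using e2
  have e3 : x 3 = 0 := by simpa [e1, e2, hnz hδ₁] using h2
  intro i
  fin_cases i <;> assumption

theorem isSpecialCubic [Finite K] (hφ : IsCubicFrobenius φ) (h : Factors b φ c δ a d)
    (hδ : δ ∉ Set.range (algebraMap K F)) (ha : a 2 ≠ 0)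
    {L : ℙ F (Fin 3 → F)} (hL : L ∈ (lineInfty F).projectivization)
    {ℓ : Fin 3 → F} (hLℓ : L.submodule = Submodule.span F {ℓ}) {ρ : F}
    (hρ : d - δ • a = ρ • ℓ) (hne : d - δ • a ≠ 0) : IsSpecialCubic b L c := by
  have hF := finrank_eq_three b
  have hli := h.linearIndependent hφ hδ ha hne
  have hH : ¬ Submodule.span K (Set.range c) ≤ hyperplaneInfty K := by
    intro hle
    have h6 : c 0 6 = 0 := hle (Submodule.subset_span ⟨0, rfl⟩)
    apply ha
    rw [← h.zero, planeCoords_apply_two, h6, map_zero]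
  refine ⟨hli, ?_, hH, ?_⟩
  · have hle : Submodule.span K (Set.range c) ⊓ hyperplaneInfty K ≤ spreadElement b L := by
      rintro v ⟨hv, hv6⟩
      obtain ⟨x, rfl⟩ := (Submodule.mem_span_range_iff_exists_fun K).1 hv
      have h2 : planeCoords b (∑ j, x j • c j) 2 = 0 := by
        rw [planeCoords_apply_two, show (∑ j, x j • c j) 6 = 0 from hv6, map_zero]
      rw [mem_spreadElement b hL, hLℓ]
      rw [h.planeCoords_sum] at h2 ⊢
      rw [(h.add_smul_eq ha h2).2, hρ, smul_smul]
      exact Submodule.smul_mem _ _ (Submodule.mem_span_singleton_self _)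
    rw [← Submodule.eq_of_le_of_finrank_eq hle (by
      rw [finrank_spreadElement b hL, finrank_span_inf_hyperplaneInfty hli hH])]
    exact inf_le_left
  · intro g hg
    obtain ⟨τ, hτ⟩ := hg.exists_transversal_le
    -- At this parameter the `κ`-coordinates contain the factors `κ(φ δ) - τ δ` and `κ(φ² δ) - τ δ`.
    -- For `κ ≠ τ` one of them vanishes, as `τ` is `κφ` or `κφ²`.
    refine ⟨-τ δ, 1, by simp, hτ ?_⟩
    have hzero : ∀ κ, κ ≠ τ → conjCoords b κ (cubic (fun j => embed F (c j)) (-τ δ) 1) = 0 := by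
      intro κ hκ
      ext i
      have hfac : conjCoords b κ (cubic (fun j => embed F (c j)) (-τ δ) 1) i =
          (-τ δ * κ (a i) + κ (d i)) * ((κ (φ δ) - τ δ) * (κ (φ (φ δ)) - τ δ)) := by
        rw [conjCoords_cubic_embed, h.zero, h.one, h.two, h.three]
        simp only [map_add, map_mul]
        ring
      have hroot : κ (φ δ) = τ δ ∨ κ (φ (φ δ)) = τ δ := by
        have hmul : τ δ = κ ((κ⁻¹ * τ) δ) := by
          rw [← AlgEquiv.mul_apply, mul_inv_cancel_left]
        rcases hφ.eq_of_mem_gal (κ⁻¹ * τ) with h1 | h1 | h1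
        · exact absurd (inv_mul_eq_one.1 h1) hκ
        · left; rw [hmul, h1]
        · right; rw [hmul, h1]; rfl
      rw [hfac]
      rcases hroot with h1 | h1 <;> simp [h1]
    refine ⟨?_, hzero⟩
    have hne1 : φ * τ ≠ τ := fun h1 => hφ.ne_one hF (mul_eq_right.1 h1)
    exact congrFun (hzero _ hne1) 2

end Factors

/-- The points `⟨s a + t d⟩`, with `s`, `t` in `GF(q)`. -/
def sublinePoints (K : Type*) {F : Type*} [Field K] [Field F] [Algebra K F] (a d : Fin 3 → F) :
    Set (ℙ F (Fin 3 → F)) :=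
  {P | ∃ s t : K, (s, t) ≠ (0, 0) ∧
    P.submodule = Submodule.span F {algebraMap K F s • a + algebraMap K F t • d}}

/-- In plane coordinates the cubic is a nonzero multiple of `s a + t d` with nonzero last coordinate
in `K`, so dividing by that coordinate gives the affine point. -/
theorem Factors.cubicPoints_eq {b} {φ : F ≃ₐ[K] F} {c : Fin 4 → Fin 7 → K} {δ : F}
    {a d : Fin 3 → F} (hφ : IsCubicFrobenius φ) (h : Factors b φ c δ a d)
    (hδ : δ ∉ Set.range (algebraMap K F)) (ha : a 2 ≠ 0) :
    cubicPoints c = affineImage b (sublinePoints K a d) := by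
  have hδ₁ := hφ.notMem_range hδ
  have hδ₂ := hφ.notMem_range hδ₁
  have hN : ∀ {s t : K}, (s, t) ≠ (0, 0) → (algebraMap K F s + algebraMap K F t * φ δ) *
      (algebraMap K F s + algebraMap K F t * φ (φ δ)) ≠ 0 := fun hst =>
    mul_ne_zero (add_mul_ne_zero hδ₁ hst) (add_mul_ne_zero hδ₂ hst)
  have hspan : ∀ (v w : Fin 7 → K) (z : K), z ≠ 0 → v = z • w →
      Submodule.span K {v} = Submodule.span K {w} := by
    rintro _ w z hz rfl
    exact Submodule.span_singleton_smul_eq (IsUnit.mk0 z hz) w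
  ext Q
  constructor
  · rintro ⟨s, t, hst, hQ⟩
    have hz := h.cubic_apply_six hφ hδ ha hst
    set v := cubic c s t with hv
    have hvN := h.planeCoords_cubic s t
    rw [← hv] at hvN
    have hp0 : algebraMap K F s • a + algebraMap K F t • d ≠ 0 := by
      intro h0
      rw [h0, smul_zero] at hvN
      have := congrFun hvN 2
      rw [planeCoords_apply_two] at this
      exact hz ((map_eq_zero _).1 this)
    let w := (v 6)⁻¹ • v
    have hw6 : w 6 = 1 := inv_mul_cancel₀ hz
    have hw : planeCoords b w = ![planeCoords b w 0, planeCoords b w 1, 1] := by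
      ext i
      fin_cases i
      · rfl
      · rfl
      · simp [planeCoords_apply_two, hw6]
    refine ⟨Projectivization.mk F _ hp0, ⟨s, t, hst, Projectivization.submodule_mk _ _⟩,
      planeCoords b w 0, planeCoords b w 1, ?_, ?_⟩
    · rw [← hw, Projectivization.submodule_mk, Submodule.mem_span_singleton]
      refine ⟨algebraMap K F (v 6)⁻¹ * ((algebraMap K F s + algebraMap K F t * φ δ) *
        (algebraMap K F s + algebraMap K F t * φ (φ δ))), ?_⟩
      rw [← smul_smul, ← hvN]
      ext i
      rw [planeCoords_smul]
      rfl
    · have := sigma_planeCoords b w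
      rw [hw6] at this
      rw [this, hQ]
      refine hspan v w (v 6) hz ?_
      rw [smul_smul, mul_inv_cancel₀ hz, one_smul]
  · rintro ⟨P, ⟨s, t, hst, hP⟩, α, β, hmem, hQ⟩
    refine ⟨s, t, hst, ?_⟩
    rw [hP, Submodule.mem_span_singleton] at hmem
    obtain ⟨x, hx⟩ := hmem
    have hx0 : x ≠ 0 := by
      rintro rfl
      have := congrFun hx 2
      simp at this
    have hz := h.cubic_apply_six hφ hδ ha hst
    rw [hQ]
    symm
    refine hspan _ _ (cubic c s t 6) hz ?_
    apply planeCoords_injective b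
    have hvN := h.planeCoords_cubic s t
    have hx' : algebraMap K F s • a + algebraMap K F t • d = x⁻¹ • ![α, β, 1] := by
      rw [← hx, smul_smul, inv_mul_cancel₀ hx0, one_smul]
    rw [hx', smul_smul] at hvN
    have h6 := congrFun hvN 2
    rw [planeCoords_apply_two] at h6
    ext i
    rw [planeCoords_smul, planeCoords_sigma, map_one, hvN, h6]
    simp

/-- The vector `e` completes the subline to a subplane; up to sign the determinant is `ρ` times a
nonzero coordinate of `ℓ`. -/
theorem exists_third_point {a ℓ : Fin 3 → F} (ha : a 2 = 1) (hℓ : ℓ 2 = 0) (hℓ0 : ℓ ≠ 0) :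
    ∃ e : Fin 3 → F, ∀ (δ ρ : F), ρ ≠ 0 →
      IsUnit (Matrix.of ![a, δ • a + ρ • ℓ, e]) := by
  by_cases h0 : ℓ 0 = 0
  · have h1 : ℓ 1 ≠ 0 := by
      intro h1
      apply hℓ0
      ext i; fin_cases i <;> assumption
    refine ⟨![1, 0, 0], fun δ ρ hρ => ?_⟩
    rw [Matrix.isUnit_iff_isUnit_det, Matrix.det_fin_three, isUnit_iff_ne_zero]
    simp [ha, hℓ, h0]
    rw [show a 1 * δ - (δ * a 1 + ρ * ℓ 1) = -(ρ * ℓ 1) by ring]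
    exact neg_ne_zero.2 (mul_ne_zero hρ h1)
  · refine ⟨![0, 1, 0], fun δ ρ hρ => ?_⟩
    rw [Matrix.isUnit_iff_isUnit_det, Matrix.det_fin_three, isUnit_iff_ne_zero]
    simp [ha, hℓ]
    rw [show -(a 0 * δ) + (δ * a 0 + ρ * ℓ 0) = ρ * ℓ 0 by ring]
    exact mul_ne_zero hρ h0

theorem isSubline_sublinePoints {m : Submodule F (Fin 3 → F)} (hm : Module.finrank F m = 2)
    {a d e : Fin 3 → F} (ha : a ∈ m) (hd : d ∈ m) (hu : IsUnit (Matrix.of ![a, d, e])) :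
    IsSubline K m (sublinePoints K a d) := by
  have hli : LinearIndependent F ![a, d, e] := Matrix.linearIndependent_rows_iff_isUnit.2 hu
  have he : e ∉ m := by
    intro he
    have hle : Submodule.span F (Set.range ![a, d, e]) ≤ m := by
      rw [Submodule.span_le]
      rintro _ ⟨i, rfl⟩
      fin_cases i
      · exact ha
      · exact hd
      · exact he
    have := Submodule.finrank_mono hle
    rw [finrank_span_eq_card hli, hm] at this
    simp at this
  have huT : IsUnit (Matrix.of ![a, d, e]).transpose := (Matrix.isUnit_transpose _).2 hu
  obtain ⟨A, hA⟩ := huT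
  have hmul : ∀ v : Fin 3 → F, (A : Matrix (Fin 3) (Fin 3) F).mulVec v =
      v 0 • a + v 1 • d + v 2 • e := by
    intro v
    rw [hA]
    ext i
    simp [Matrix.mulVec, dotProduct, Fin.sum_univ_three]
    ring
  have hcoef : ∀ x y z : F, x • a + y • d + z • e = 0 → x = 0 ∧ y = 0 ∧ z = 0 := by
    intro x y z h
    have := Fintype.linearIndependent_iff.1 hli ![x, y, z] (by simpa [Fin.sum_univ_three] using h)
    exact ⟨this 0, this 1, this 2⟩
  let B : Set (ℙ F (Fin 3 → F)) := {P | ∃ v : Fin 3 → K, v ≠ 0 ∧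
      P.submodule = Submodule.span F {(A : Matrix (Fin 3) (Fin 3) F).mulVec
        (fun i => algebraMap K F (v i))}}
  have hBm : sublinePoints K a d = B ∩ (m.projectivization : Set (ℙ F (Fin 3 → F))) := by
    ext P
    constructor
    · rintro ⟨s, t, hst, hP⟩
      refine ⟨⟨![s, t, 0], ?_, ?_⟩, ?_⟩
      · intro h
        exact hst (Prod.ext (congrFun h 0) (congrFun h 1))
      · rw [hP, hmul]
        simp
      · rw [SetLike.mem_coe, Submodule.mem_projectivization_iff_submodule_le, hP,
          Submodule.span_singleton_le_iff_mem]
        exact m.add_mem (m.smul_mem _ ha) (m.smul_mem _ hd)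
    · rintro ⟨⟨v, hv, hP⟩, hPm⟩
      rw [hmul] at hP
      rw [SetLike.mem_coe, Submodule.mem_projectivization_iff_submodule_le, hP,
          Submodule.span_singleton_le_iff_mem,
          m.add_mem_iff_right (m.add_mem (m.smul_mem _ ha) (m.smul_mem _ hd))] at hPm
      have hv2 : v 2 = 0 := by
        by_contra h2
        exact he ((m.smul_mem_iff (by simpa using h2)).1 hPm)
      refine ⟨v 0, v 1, ?_, ?_⟩
      · intro h
        apply hv
        simp only [Prod.mk.injEq] at h
        ext i; fin_cases i
        · exact h.1
        · exact h.2
        · exact hv2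
      · rw [hP, hv2]
        simp
  refine ⟨B, ⟨A, rfl⟩, ⟨hm, ?_⟩, hBm⟩
  have ha0 : a ≠ 0 := hli.ne_zero 0
  have hd0 : d ≠ 0 := hli.ne_zero 1
  rw [← hBm]
  refine ⟨Projectivization.mk F a ha0, ⟨1, 0, by simp, by simp [Projectivization.submodule_mk]⟩,
    Projectivization.mk F d hd0, ⟨0, 1, by simp, by simp [Projectivization.submodule_mk]⟩, ?_⟩
  rw [Ne, Projectivization.mk_eq_mk_iff']
  rintro ⟨x, hx⟩
  have := hcoef 1 (-x) 0 (by rw [← hx]; simp)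
  simp at this

theorem disjoint_sublinePoints {δ : F} {a d : Fin 3 → F}
    (hδ : δ ∉ Set.range (algebraMap K F)) (ha : a 2 = 1) (hd : d 2 = δ) :
    Disjoint (sublinePoints K a d) ((lineInfty F).projectivization : Set (ℙ F (Fin 3 → F))) := by
  rw [Set.disjoint_left]
  rintro P ⟨s, t, hst, hP⟩ hPL
  rw [SetLike.mem_coe, Submodule.mem_projectivization_iff_submodule_le, hP,
    Submodule.span_singleton_le_iff_mem] at hPL
  have h2 := mem_lineInfty_iff.1 hPL
  simp only [Pi.add_apply, Pi.smul_apply, smul_eq_mul, ha, hd, mul_one] at h2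
  exact add_mul_ne_zero hδ hst h2

theorem exists_affine_point {m : Submodule F (Fin 3 → F)} (hm : Module.finrank F m = 2)
    (hne : m ≠ lineInfty F) : ∃ a ∈ m, a 2 = 1 := by
  have : ¬ m ≤ lineInfty F := fun h =>
    hne (Submodule.eq_of_le_of_finrank_eq h (by rw [hm, finrank_lineInfty]))
  obtain ⟨x, hx, hx2⟩ := SetLike.not_le_iff_exists.1 this
  have hx2 : x 2 ≠ 0 := hx2
  exact ⟨(x 2)⁻¹ • x, m.smul_mem _ hx, inv_mul_cancel₀ hx2⟩

theorem squarePoints_mem_shadowsOn [Finite K] {L : ℙ F (Fin 3 → F)}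
    (hL : L ∈ (lineInfty F).projectivization) {ℓ : Fin 3 → F} (hℓ : ℓ 2 = 0)
    (hLℓ : L.submodule = Submodule.span F {ℓ}) {m : Submodule F (Fin 3 → F)}
    (hm : Module.finrank F m = 2) (hne : m ≠ lineInfty F) (hLm : L ∈ m.projectivization)
    {δ ρ : F} (hδ : δ ∉ Set.range (algebraMap K F)) (hρ : ρ ≠ 0) :
    squarePoints b ℓ (pencil K δ) ρ ∈ shadowsOn b L m := by
  obtain ⟨φ, hφ⟩ := exists_isCubicFrobenius (K := K) (F := F) (finrank_eq_three b)
  obtain ⟨a, ham, ha⟩ := exists_affine_point hm hne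
  have ha' : a 2 ≠ 0 := by rw [ha]; exact one_ne_zero
  have hℓm : ℓ ∈ m := by
    rw [Submodule.mem_projectivization_iff_submodule_le, hLℓ,
      Submodule.span_singleton_le_iff_mem] at hLm
    exact hLm
  have hℓ0 : ℓ ≠ 0 := by
    intro h
    have := L.finrank_submodule
    rw [hLℓ, h, Submodule.span_zero_singleton, finrank_bot] at this
    omega
  obtain ⟨e, he⟩ := exists_third_point ha hℓ hℓ0
  have hd : (δ • a + ρ • ℓ) 2 = δ := by simp [ha, hℓ]
  have hdiff : δ • a + ρ • ℓ - δ • a = ρ • ℓ := add_sub_cancel_left _ _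
  obtain ⟨c, hc⟩ := exists_factors b hφ ha hd
  refine ⟨sublinePoints K a (δ • a + ρ • ℓ),
    isSubline_sublinePoints hm ham (m.add_mem (m.smul_mem _ ham) (m.smul_mem _ hℓm)) (he δ ρ hρ),
    disjoint_sublinePoints hδ ha hd, c,
    hc.isSpecialCubic hφ hδ ha' hL hLℓ hdiff ?_, hc.cubicPoints_eq hφ hδ ha', ?_⟩
  · rw [hdiff]
    exact smul_ne_zero hρ hℓ0
  · rw [hc.shadowPoints_eq hφ hδ ha' hL hℓ hLℓ hdiff]

end Sublines

/-! ### Counting the sets `squarePoints`. -/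

section Counting

variable {K F : Type*} [Field K] [Field F] [Algebra K F] (b : Module.Basis (Fin 3) K F)

theorem squarePoints_pencil_eq {ℓ : Fin 3 → F} {δ ε r : F} (hr : r ≠ 0)
    (h : ∀ w, w ∈ pencil K δ ↔ r * w ∈ pencil K ε) (ρ : F) :
    squarePoints b ℓ (pencil K δ) ρ = squarePoints b ℓ (pencil K ε) (ρ * r ^ 2) := by
  ext Q
  constructor
  · rintro ⟨w, hw, hw0, hQ⟩
    refine ⟨r * w, (h w).1 hw, mul_ne_zero hr hw0, ?_⟩
    rw [hQ]
    congr 3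
    field_simp
  · rintro ⟨w, hw, hw0, hQ⟩
    refine ⟨r⁻¹ * w, (h _).2 (by rwa [mul_inv_cancel_left₀ hr]),
      mul_ne_zero (inv_ne_zero hr) hw0, ?_⟩
    rw [hQ]
    congr 3
    field_simp

theorem squarePoints_smul (ℓ : Fin 3 → F) (W : Submodule K F) (ρ : F) {k : K} (hk : k ≠ 0) :
    squarePoints b ℓ W (k • ρ) = squarePoints b ℓ W ρ := by
  ext Q
  refine exists_congr fun w => and_congr_right fun _ => and_congr_right fun _ => ?_
  rw [show k • ρ / w ^ 2 = k • (ρ / w ^ 2) by rw [smul_div_assoc], map_smul,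
    Submodule.span_singleton_smul_eq (IsUnit.mk0 k hk)]

/-- Write `ρ'/ρ = k r²` with `k` in `K`. Equality of the two sets matches each `w` with some `w'`
such that `(w'/(rw))²` lies in `K`. Then `w'/(rw)` itself lies in `K`, so `rW ⊆ W`, which forces `r`
into `K`. -/
theorem exists_smul_eq_of_squarePoints_eq [Finite K] {ℓ : Fin 3 → F} (hℓ : ℓ 2 = 0)
    (hℓ0 : ℓ ≠ 0) {W : Submodule K F} (hW : Module.finrank K W = 2) {ρ ρ' : F} (hρ : ρ ≠ 0)
    (hρ' : ρ' ≠ 0) (h : squarePoints b ℓ W ρ = squarePoints b ℓ W ρ') :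
    ∃ k : K, k • ρ' = ρ := by
  have hF := finrank_eq_three b
  obtain ⟨r, k, hr, hk, hrk⟩ := exists_eq_sq_mul hF (div_ne_zero hρ' hρ)
  have hk' : algebraMap K F k ≠ 0 := by simpa using hk
  have hinj := spreadMap_injective b hℓ hℓ0
  have hstab : ∀ w ∈ W, r * w ∈ W := by
    intro w hw
    by_cases hw0 : w = 0
    · simp [hw0]
    have hne : spreadMap b ℓ (ρ / w ^ 2) ≠ 0 := by
      rw [Ne, map_eq_zero_iff _ hinj]
      positivity
    have hmem : Projectivization.mk K _ hne ∈ squarePoints b ℓ W ρ :=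
      ⟨w, hw, hw0, Projectivization.submodule_mk _ _⟩
    rw [h] at hmem
    obtain ⟨w', hw', hw0', hQ⟩ := hmem
    rw [Projectivization.submodule_mk] at hQ
    have hspan : spreadMap b ℓ (ρ / w ^ 2) ∈ Submodule.span K {spreadMap b ℓ (ρ' / w' ^ 2)} := by
      rw [← hQ]
      exact Submodule.mem_span_singleton_self _
    obtain ⟨z, hz⟩ := Submodule.mem_span_singleton.1 hspan
    rw [← map_smul] at hz
    have hz := hinj hz
    rw [Algebra.smul_def] at hz
    have hz0 : algebraMap K F z ≠ 0 := by
      intro h0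
      rw [h0, zero_mul] at hz
      exact div_ne_zero hρ (pow_ne_zero 2 hw0) hz.symm
    have hsq : (w' / (r * w)) ^ 2 = algebraMap K F (z * k) := by
      rw [div_eq_iff hρ] at hrk
      rw [hrk] at hz
      rw [map_mul]
      field_simp at hz ⊢
      linear_combination -hz
    obtain ⟨y, hy⟩ := mem_range_of_sq_mem_range hF hsq
    have hy0 : y ≠ 0 := by
      rintro rfl
      rw [map_zero] at hy
      exact div_ne_zero hw0' (mul_ne_zero hr hw0) hy.symm
    have hyr : r * w = y⁻¹ • w' := by
      rw [Algebra.smul_def, map_inv₀, hy]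
      field_simp
    rw [hyr]
    exact W.smul_mem _ hw'
  obtain ⟨y, hy⟩ := mem_range_of_mul_mem hF W hW hstab
  refine ⟨(k * y ^ 2)⁻¹, ?_⟩
  rw [div_eq_iff hρ] at hrk
  rw [Algebra.smul_def, map_inv₀, map_mul, map_pow, hy, hrk]
  field_simp

theorem ncard_squarePoints [Finite K] {ℓ : Fin 3 → F} (hℓ : ℓ 2 = 0) (hℓ0 : ℓ ≠ 0)
    {W : Submodule K F} (hW : Module.finrank K W = 2) :
    {D | ∃ ρ, ρ ≠ 0 ∧ D = squarePoints b ℓ W ρ}.ncard = Nat.card K ^ 2 + Nat.card K + 1 := by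
  have hF := finrank_eq_three b
  let f : ℙ K F → Set (ℙ K (Fin 7 → K)) := fun p => squarePoints b ℓ W p.rep
  have hf : Function.Injective f := by
    intro p p' h
    obtain ⟨k, hk⟩ := exists_smul_eq_of_squarePoints_eq b hℓ hℓ0 hW p.rep_nonzero
      p'.rep_nonzero h
    rw [← p.mk_rep, ← p'.mk_rep, Projectivization.mk_eq_mk_iff']
    exact ⟨k, hk⟩
  have hr : {D | ∃ ρ, ρ ≠ 0 ∧ D = squarePoints b ℓ W ρ} = Set.range f := by
    ext D
    constructor
    · rintro ⟨ρ, hρ, rfl⟩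
      obtain ⟨k, hk⟩ := Projectivization.exists_smul_eq_mk_rep K ρ hρ
      refine ⟨Projectivization.mk K ρ hρ, ?_⟩
      simp only [f]
      rw [← hk]
      exact squarePoints_smul b ℓ W ρ k.ne_zero
    · rintro ⟨p, rfl⟩
      exact ⟨p.rep, p.rep_nonzero, rfl⟩
  rw [hr, Set.ncard_range_of_injective hf, Projectivization.card_of_finrank K F hF]
  simp [Finset.sum_range_succ]
  ring

theorem IsSpecialCubic.exists_shadowPoints_eq [Finite K] {L : ℙ F (Fin 3 → F)}
    (hL : L ∈ (lineInfty F).projectivization) {ℓ : Fin 3 → F} (hℓ : ℓ 2 = 0)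
    (hLℓ : L.submodule = Submodule.span F {ℓ}) {c : Fin 4 → Fin 7 → K}
    (hc : IsSpecialCubic b L c) {ε : F} (hε : ε ∉ Set.range (algebraMap K F)) :
    ∃ ρ, ρ ≠ 0 ∧ shadowPoints b L c = squarePoints b ℓ (pencil K ε) ρ := by
  have hF := finrank_eq_three b
  obtain ⟨φ, hφ⟩ := exists_isCubicFrobenius (K := K) (F := F) hF
  obtain ⟨δ, ρ, a, d, hδ, hρ, ha, hfac, hdiff⟩ := hc.exists_factors b hL hLℓ hφ
  obtain ⟨r, hr, h⟩ := exists_pencil_eq_smul hF hδ hε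
  refine ⟨ρ * r ^ 2, mul_ne_zero hρ (pow_ne_zero 2 hr), ?_⟩
  rw [hfac.shadowPoints_eq hφ hδ ha hL hℓ hLℓ hdiff, squarePoints_pencil_eq b hr h]

theorem exists_line_through {L : ℙ F (Fin 3 → F)} (hL : L ∈ (lineInfty F).projectivization) :
    ∃ m : Submodule F (Fin 3 → F), Module.finrank F m = 2 ∧ m ≠ lineInfty F ∧
      L ∈ m.projectivization := by
  have hℓ : L.rep 2 = 0 := by
    rw [Submodule.mem_projectivization_iff_submodule_le, L.submodule_eq,
      Submodule.span_singleton_le_iff_mem] at hL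
    exact hL
  have hli : LinearIndependent F ![L.rep, ![0, 0, 1]] := by
    rw [LinearIndependent.pair_iff]
    intro s t h
    have ht : t = 0 := by simpa [hℓ] using congrFun h 2
    subst ht
    simpa [L.rep_nonzero] using h
  refine ⟨Submodule.span F (Set.range ![L.rep, ![0, 0, 1]]), ?_, ?_, ?_⟩
  · rw [finrank_span_eq_card hli]; rfl
  · intro h
    have : ![0, 0, 1] ∈ lineInfty F := by
      rw [← h]
      exact Submodule.subset_span ⟨1, rfl⟩
    exact one_ne_zero (mem_lineInfty_iff.1 this)
  · rw [Submodule.mem_projectivization_iff_submodule_le, L.submodule_eq,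
      Submodule.span_singleton_le_iff_mem]
    exact Submodule.subset_span ⟨0, rfl⟩

end Counting

end BruckBose

theorem lemma5p4 {K F : Type*} [Field K] [Finite K] [Field F] [Algebra K F]
    (b : Module.Basis (Fin 3) K F)
    (B : Set (ℙ F (Fin 3 → F))) (T L : ℙ F (Fin 3 → F))
    (hB : BruckBose.IsTangentSubplane K B T)
    (hL : L ∈ BruckBose.splash B) (hLT : L ≠ T) :
    (BruckBose.shadowsIn b L).ncard = Nat.card K ^ 2 + Nat.card K + 1 ∧
    ∀ m : Submodule F (Fin 3 → F), Module.finrank F m = 2 → m ≠ BruckBose.lineInfty F →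
      L ∈ m.projectivization →
      (BruckBose.shadowsOn b L m).ncard = Nat.card K ^ 2 + Nat.card K + 1 := by
  have hLinf := hL.1
  have hℓ : L.rep 2 = 0 := by
    rw [Submodule.mem_projectivization_iff_submodule_le, L.submodule_eq,
      Submodule.span_singleton_le_iff_mem] at hLinf
    exact hLinf
  obtain ⟨ε, hε⟩ := BruckBose.exists_notMem_range (BruckBose.finrank_eq_three b)
  have hcount := BruckBose.ncard_squarePoints b hℓ L.rep_nonzero (BruckBose.finrank_pencil hε)
  have hle : ∀ m, BruckBose.shadowsOn b L m ⊆
      {D | ∃ ρ, ρ ≠ 0 ∧ D = BruckBose.squarePoints b L.rep (BruckBose.pencil K ε) ρ} := by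
    rintro m D ⟨l, -, -, c, hc, -, rfl⟩
    exact hc.exists_shadowPoints_eq b hLinf hℓ L.submodule_eq hε
  -- The bounding set is the same for all `m`, so the shadows on one line already exhaust those in
  -- `[L]`.
  have hge : ∀ m : Submodule F (Fin 3 → F), Module.finrank F m = 2 → m ≠ BruckBose.lineInfty F →
      L ∈ m.projectivization →
      {D | ∃ ρ, ρ ≠ 0 ∧ D = BruckBose.squarePoints b L.rep (BruckBose.pencil K ε) ρ} ⊆
      BruckBose.shadowsOn b L m := by
    rintro m hm hne hLm D ⟨ρ, hρ, rfl⟩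
    exact BruckBose.squarePoints_mem_shadowsOn b hLinf hℓ L.submodule_eq hm hne hLm hε hρ
  constructor
  · rw [← hcount]
    congr 1
    apply Set.Subset.antisymm
    · rintro D ⟨m, -, hD⟩
      exact hle m hD
    · obtain ⟨m, hm, hne, hLm⟩ := BruckBose.exists_line_through hLinf
      exact fun D hD => ⟨m, hLm, hge m hm hne hLm hD⟩
  · intro m hm hne hLm
    rw [← hcount, Set.Subset.antisymm (hle m) (hge m hm hne hLm)]
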